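/- Let $\omega\in(0,1)$ and let $(a_k)_{k\ge1}$, $(b_k)_{k\ge1}$ be sequences of positive reals with $a_1\le a_2\le\cdots$ and $\inf_k b_k>0$. For $d\ge1$ let $H_d$ be the reproducing kernel Hilbert space of complex-valued functions on $[0,1]^d$ with the analytic Korobov kernel $$K_d(x,y)=\prod_{k=1}^d\ \sum_{h\in\mathbb Z}\omega^{a_k|h|^{b_k}}e^{2\pi i h(x_k-y_k)},$$ and let $\mathrm{APP}_d:H_d\to L_2([0,1]^d)$, $\mathrm{APP}_d f=f$. For $n\ge1$ let $$e(n,d)=\inf_{L_1,\dots,L_n,\phi}\ \sup_{\|f\|_{H_d}\le1}\|f-\phi(L_1f,\dots,L_nf)\|_{L_2},$$ the infimum being over continuous linear functionals $L_1,\dots,L_n$ on $H_d$ and measurable maps $\phi:\mathbb C^n\to L_2([0,1]^d)$, and let $e(0,d)=\sup_{\|f\|_{H_d}\le 1}\|f\|_{L_2}$. Let $n(\varepsilon,d)=\min\{n\ge0: e(n,d)\le\varepsilon\,\mathrm{CRI}_d\}$, where $\mathrm{CRI}_d=1$ for the absolute error criterion and $\mathrm{CRI}_d=e(0,d)$ for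 the normalized error criterion. In the following, $d$ ranges over $\{1,2,\dots\}$ and $\varepsilon$ over $(0,1)$. The problem is - strongly polynomially tractable (SPT) if there are $C,p\ge0$ with $n(\varepsilon,d)\le C\varepsilon^{-p}$ for all $d,\varepsilon$; the exponent $p^*$ is the infimum of such $p$; - polynomially tractable (PT) if there are $C,p,q\ge0$ with $n(\varepsilon,d)\le Cd^q\varepsilon^{-p}$ for all $d,\varepsilon$; - quasi-polynomially tractable (QPT) if there are $C,t>0$ with $n(\varepsilon,d)\le C\exp\big(t(1+\ln d)(1+\ln\varepsilon^{-1})\big)$ for all $d,\varepsilon$; the exponent $t^*$ is the infimum of such $t$; - $(s,t)$-weakly tractable ($s,t>0$) if $\ln n(\varepsilon,d)/(\varepsilon^{-s}+d^t)\to0$ as $\varepsilon^{-1}+d\to\infty$; weakly tractable if this holds for $s=t=1$; uniformly weakly tractable if it holds for all $s,t>0$. Then, for either error criterion, with the convention $2/\infty=0$: 1. SPT holds if and only if $$A_*:=\liminf_{k\to\infty}\frac{a_k\ln\omega^{-1}}{\ln k}=\ln\omega^{-1}\,\liminf_{k\to\infty}\frac{a_k}{\ln k}>0,$$ and in that case $p^*=2/A_*$.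 2. SPT holds if and only if PT holds. 3. QPT always holds, with $t^*=2/B$, where $B=\ln\omega^{-1}\cdot\lim_{k\to\infty}a_k\in(0,\infty]$. 4. $(s,t)$-weak tractability for all $s,t>0$, uniform weak tractability and weak tractability always hold. -/

import Mathlib

open MeasureTheory Filter Topology
open scoped ENNReal

noncomputable section

/-! ### Worst case approximation and information complexity -/

/-- The two error criteria: absolute (`ABS`) and normalized (`NOR`). -/
inductive ErrorCriterion where
  | ABS
  | NOR

section WorstCase

variable {H G : Type*} [NormedAddCommGroup H] [NormedSpace ℂ H]
  [NormedAddCommGroup G] [NormedSpace ℂ G]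

/-- Worst case error over the unit ball of `H` of the algorithm
`f ↦ φ (L₁ f, …, Lₙ f)` for approximating `T`. -/
def algorithmError (T : H →L[ℂ] G) {n : ℕ} (L : Fin n → H →L[ℂ] ℂ)
    (φ : (Fin n → ℂ) → G) : ℝ≥0∞ :=
  ⨆ f ∈ Metric.closedBall (0 : H) 1, ‖T f - φ (fun i => L i f)‖ₑ

/-- The `n`-th minimal worst case error.  For `n = 0` it is the initial error, i.e. the error of
the zero algorithm; for `n ≥ 1` it is the infimum of the worst case errors over all algorithms
`f ↦ φ (L₁ f, …, Lₙ f)` with continuous linear functionals `Lᵢ` and an arbitrary (Borel)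
measurable map `φ`. -/
def minimalError (T : H →L[ℂ] G) : ℕ → ℝ≥0∞
  | 0 => ⨆ f ∈ Metric.closedBall (0 : H) 1, ‖T f‖ₑ
  | n + 1 => ⨅ (L : Fin (n + 1) → H →L[ℂ] ℂ) (φ : (Fin (n + 1) → ℂ) → G)
      (_ : Measurable[inferInstance, borel G] φ), algorithmError T L φ

/-- The factor multiplying `ε` in the error criterion. -/
def criterionScale (X : ErrorCriterion) (T : H →L[ℂ] G) : ℝ≥0∞ :=
  match X with
  | .ABS => 1
  | .NOR => minimalError T 0

/-- The information complexity: the least `n` whose minimal error is at most `ε` times the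
scale of the criterion (`⊤` if there is no such `n`). -/
def informationComplexity (X : ErrorCriterion) (T : H →L[ℂ] G) (ε : ℝ) : ℕ∞ :=
  ⨅ (n : ℕ) (_ : minimalError T n ≤ ENNReal.ofReal ε * criterionScale X T), (n : ℕ∞)

end WorstCase

/-! ### Tractability notions

`N ε d` stands for the information complexity of the `d`-variate problem with error threshold
`ε`; only `d ≥ 1` and `ε ∈ (0, 1)` matter. -/

section Tractability

/-- `N(ε, d) ≤ C ε⁻ᵖ` for some `C ≥ 0` and all `d`, `ε`. -/
def SPTBound (N : ℝ → ℕ → ℕ∞) (p : ℝ) : Prop :=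
  ∃ C : ℝ, 0 ≤ C ∧ ∀ d : ℕ, 1 ≤ d → ∀ ε ∈ Set.Ioo (0 : ℝ) 1,
    (N ε d : ℝ≥0∞) ≤ ENNReal.ofReal (C * ε⁻¹ ^ p)

/-- Strong polynomial tractability. -/
def IsSPT (N : ℝ → ℕ → ℕ∞) : Prop := ∃ p : ℝ, 0 ≤ p ∧ SPTBound N p

/-- The exponent of SPT: the infimum of all `p ≥ 0` for which the SPT bound holds. -/
def exponentSPT (N : ℝ → ℕ → ℕ∞) : EReal :=
  ⨅ (p : ℝ) (_ : 0 ≤ p ∧ SPTBound N p), (p : EReal)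

/-- Polynomial tractability. -/
def IsPT (N : ℝ → ℕ → ℕ∞) : Prop :=
  ∃ C p q : ℝ, 0 ≤ C ∧ 0 ≤ p ∧ 0 ≤ q ∧ ∀ d : ℕ, 1 ≤ d → ∀ ε ∈ Set.Ioo (0 : ℝ) 1,
    (N ε d : ℝ≥0∞) ≤ ENNReal.ofReal (C * (d : ℝ) ^ q * ε⁻¹ ^ p)

/-- `N(ε, d) ≤ C exp(t (1 + ln d) (1 + ln ε⁻¹))` for some `C > 0` and all `d`, `ε`. -/
def QPTBound (N : ℝ → ℕ → ℕ∞) (t : ℝ) : Prop :=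
  ∃ C : ℝ, 0 < C ∧ ∀ d : ℕ, 1 ≤ d → ∀ ε ∈ Set.Ioo (0 : ℝ) 1,
    (N ε d : ℝ≥0∞) ≤
      ENNReal.ofReal (C * Real.exp (t * (1 + Real.log d) * (1 + Real.log ε⁻¹)))

/-- Quasi-polynomial tractability. -/
def IsQPT (N : ℝ → ℕ → ℕ∞) : Prop := ∃ t : ℝ, 0 < t ∧ QPTBound N t

/-- The exponent of QPT: the infimum of all `t > 0` for which the QPT bound holds. -/
def exponentQPT (N : ℝ → ℕ → ℕ∞) : EReal :=
  ⨅ (t : ℝ) (_ : 0 < t ∧ QPTBound N t), (t : EReal)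

/-- The filter `ε⁻¹ + d → ∞` on pairs `(ε, d)` with `ε ∈ (0, 1)` and `d ≥ 1`. -/
def jointLimit : Filter (ℝ × ℕ) :=
  comap (fun q : ℝ × ℕ => q.1⁻¹ + (q.2 : ℝ)) atTop ⊓
    𝓟 {q : ℝ × ℕ | q.1 ∈ Set.Ioo (0 : ℝ) 1 ∧ 1 ≤ q.2}

/-- `(s, t)`-weak tractability: `ln N(ε, d) / (ε⁻ˢ + dᵗ) → 0` as `ε⁻¹ + d → ∞`. -/
def IsSTWT (N : ℝ → ℕ → ℕ∞) (s t : ℝ) : Prop :=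
  Tendsto (fun q : ℝ × ℕ => ENNReal.log (N q.1 q.2 : ℝ≥0∞) /
    ((q.1⁻¹ ^ s + (q.2 : ℝ) ^ t : ℝ) : EReal)) jointLimit (𝓝 0)

/-- Uniform weak tractability. -/
def IsUWT (N : ℝ → ℕ → ℕ∞) : Prop :=
  ∀ α β : ℝ, 0 < α → 0 < β →
    Tendsto (fun q : ℝ × ℕ => ENNReal.log (N q.1 q.2 : ℝ≥0∞) /
      ((q.1⁻¹ ^ α + (q.2 : ℝ) ^ β : ℝ) : EReal)) jointLimit (𝓝 0)

/-- Weak tractability: `ln N(ε, d) / (ε⁻¹ + d) → 0` as `ε⁻¹ + d → ∞`. -/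
def IsWT (N : ℝ → ℕ → ℕ∞) : Prop :=
  Tendsto (fun q : ℝ × ℕ => ENNReal.log (N q.1 q.2 : ℝ≥0∞) /
    ((q.1⁻¹ + (q.2 : ℝ) : ℝ) : EReal)) jointLimit (𝓝 0)

end Tractability

/-! ### Analytic Korobov spaces -/

/-- The univariate analytic Korobov kernel
`K(x, y) = ∑_{h ∈ ℤ} ω ^ (a |h| ^ b) exp(2 π i h (x - y))`. -/
def korobovKernel₁ (ω a b : ℝ) (x y : unitInterval) : ℂ :=
  ∑' h : ℤ, ((ω ^ (a * |(h : ℝ)| ^ b) : ℝ) : ℂ) *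
    Complex.exp (2 * Real.pi * Complex.I * h * (((x : ℝ) : ℂ) - ((y : ℝ) : ℂ)))

/-- The parameters of analytic Korobov spaces.  Sequences are indexed from `0`: `a k` and `b k`
are the parameters `a_{k+1}` and `b_{k+1}` of the coordinate number `k + 1`. -/
structure KorobovParameters where
  ω : ℝ
  a : ℕ → ℝ
  b : ℕ → ℝ
  ω_pos : 0 < ω
  ω_lt_one : ω < 1
  a_pos : ∀ k, 0 < a k
  a_mono : Monotone a
  b_pos : ∀ k, 0 < b k
  b_inf_pos : 0 < ⨅ k, b k

namespace KorobovParameters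

variable (P : KorobovParameters)

/-- The `d`-variate analytic Korobov kernel, the product of the univariate ones. -/
def kernel (d : ℕ) (x y : Fin d → unitInterval) : ℂ :=
  ∏ k : Fin d, korobovKernel₁ P.ω (P.a k) (P.b k) (x k) (y k)

/-- The kernel in the form used by `RKHS`: its entries act on `ℂ` by multiplication. -/
def kernelMatrix (d : ℕ) :
    Matrix (Fin d → unitInterval) (Fin d → unitInterval) (ℂ →L[ℂ] ℂ) :=
  Matrix.of fun x y => P.kernel d x y • ContinuousLinearMap.id ℂ ℂ

end KorobovParameters

lemma summable_korobov_nat {ω a b : ℝ} (hω : 0 < ω) (hω1 : ω < 1) (ha : 0 < a) (hb : 0 < b) :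
    Summable fun n : ℕ => ω ^ (a * (n : ℝ) ^ b) := by
  have hlog : Real.log ω < 0 := Real.log_neg hω hω1
  have hc : 0 < -Real.log ω * a := mul_pos (by linarith) ha
  have h1 := isLittleO_exp_neg_mul_rpow_atTop hc (-2 / b)
  have h2 : Tendsto (fun n : ℕ => (n : ℝ) ^ b) atTop atTop :=
    (tendsto_rpow_atTop hb).comp tendsto_natCast_atTop_atTop
  have h3 := (h1.comp_tendsto h2).isBigO
  refine summable_of_isBigO_nat (g := fun n : ℕ => (n : ℝ) ^ (-2 : ℝ))
    (Real.summable_nat_rpow.2 (by norm_num)) ?_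
  refine (h3.congr_left fun n => ?_).congr_right fun n => ?_
  · simp only [Function.comp]
    rw [Real.rpow_def_of_pos hω]
    ring_nf
  · simp only [Function.comp]
    rw [← Real.rpow_mul (Nat.cast_nonneg n)]
    congr 1
    field_simp

lemma summable_korobov {ω a b : ℝ} (hω : 0 < ω) (hω1 : ω < 1) (ha : 0 < a) (hb : 0 < b) :
    Summable fun h : ℤ => ω ^ (a * |(h : ℝ)| ^ b) := by
  refine Summable.of_nat_of_neg ?_ ?_ <;>
    simpa using summable_korobov_nat hω hω1 ha hb

lemma norm_korobov_term {ω : ℝ} (hω : 0 < ω) (a b : ℝ) (h : ℤ) (x y : unitInterval) :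
    ‖((ω ^ (a * |(h : ℝ)| ^ b) : ℝ) : ℂ) *
      Complex.exp (2 * Real.pi * Complex.I * h * (((x : ℝ) : ℂ) - ((y : ℝ) : ℂ)))‖
      = ω ^ (a * |(h : ℝ)| ^ b) := by
  have : (2 * Real.pi * Complex.I * h * (((x : ℝ) : ℂ) - ((y : ℝ) : ℂ)) : ℂ)
      = ((2 * Real.pi * h * ((x : ℝ) - (y : ℝ)) : ℝ) : ℂ) * Complex.I := by
    push_cast; ring
  rw [this, norm_mul, Complex.norm_exp_ofReal_mul_I, mul_one, Complex.norm_real,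
    Real.norm_of_nonneg (Real.rpow_nonneg hω.le _)]

lemma summable_korobovKernel₁ {ω a b : ℝ} (hω : 0 < ω) (hω1 : ω < 1) (ha : 0 < a) (hb : 0 < b)
    (x y : unitInterval) :
    Summable fun h : ℤ => ((ω ^ (a * |(h : ℝ)| ^ b) : ℝ) : ℂ) *
      Complex.exp (2 * Real.pi * Complex.I * h * (((x : ℝ) : ℂ) - ((y : ℝ) : ℂ))) :=
  Summable.of_norm (by
    simpa only [norm_korobov_term hω] using summable_korobov hω hω1 ha hb)

lemma continuous_korobovKernel₁ {ω a b : ℝ} (hω : 0 < ω) (hω1 : ω < 1) (ha : 0 < a)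
    (hb : 0 < b) (y : unitInterval) :
    Continuous fun x => korobovKernel₁ ω a b x y := by
  refine continuous_tsum (u := fun h : ℤ => ω ^ (a * |(h : ℝ)| ^ b)) (fun h => by fun_prop)
    (summable_korobov hω hω1 ha hb) fun h x => (norm_korobov_term hω a b h x y).le

lemma conj_korobovKernel₁ (ω a b : ℝ) (x y : unitInterval) :
    (starRingEnd ℂ) (korobovKernel₁ ω a b x y) = korobovKernel₁ ω a b y x := by
  unfold korobovKernel₁
  rw [Complex.conj_tsum]
  refine tsum_congr fun h => ?_
  rw [map_mul, Complex.conj_ofReal, ← Complex.exp_conj]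
  congr 2
  simp only [map_mul, map_sub, Complex.conj_ofReal, Complex.conj_I, map_ofNat, map_intCast]
  ring

namespace KorobovParameters

variable (P : KorobovParameters)

lemma conj_kernel (d : ℕ) (x y : Fin d → unitInterval) :
    (starRingEnd ℂ) (P.kernel d x y) = P.kernel d y x := by
  simp [kernel, map_prod, conj_korobovKernel₁]

lemma continuous_kernel (d : ℕ) (y : Fin d → unitInterval) :
    Continuous fun x => P.kernel d x y := by
  unfold kernel
  refine continuous_finsetProd _ fun k _ => ?_
  exact (continuous_korobovKernel₁ P.ω_pos P.ω_lt_one (P.a_pos k) (P.b_pos k) (y k)).comp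
    (continuous_apply k)

lemma kernel_self (d : ℕ) (x y : Fin d → unitInterval) :
    P.kernel d x x = P.kernel d y y := by
  simp [kernel, korobovKernel₁]

/-- Finite trigonometric sums approximating the kernel. -/
def truncKernel (d : ℕ) (s : Finset ℤ) (x y : Fin d → unitInterval) : ℂ :=
  ∏ k : Fin d, ∑ h ∈ s, ((P.ω ^ (P.a k * |(h : ℝ)| ^ P.b k) : ℝ) : ℂ) *
    Complex.exp (2 * Real.pi * Complex.I * h * (((x k : ℝ) : ℂ) - ((y k : ℝ) : ℂ)))

lemma tendsto_truncKernel (d : ℕ) (x y : Fin d → unitInterval) :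
    Tendsto (fun s => P.truncKernel d s x y) atTop (𝓝 (P.kernel d x y)) := by
  unfold truncKernel kernel korobovKernel₁
  refine tendsto_finsetProd _ fun k _ => ?_
  exact (summable_korobovKernel₁ P.ω_pos P.ω_lt_one (P.a_pos k) (P.b_pos k) (x k) (y k)).hasSum

lemma truncKernel_eq (d : ℕ) (s : Finset ℤ) (x y : Fin d → unitInterval) :
    P.truncKernel d s x y = ∑ h ∈ Fintype.piFinset fun _ : Fin d => s,
      ((∏ k : Fin d, P.ω ^ (P.a k * |(h k : ℝ)| ^ P.b k) : ℝ) : ℂ) *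
        ((∏ k, Complex.exp (2 * Real.pi * Complex.I * h k * ((x k : ℝ) : ℂ))) *
        (starRingEnd ℂ) (∏ k, Complex.exp (2 * Real.pi * Complex.I * h k * ((y k : ℝ) : ℂ)))) := by
  unfold truncKernel
  rw [Finset.prod_univ_sum]
  refine Finset.sum_congr rfl fun h _ => ?_
  rw [map_prod, Complex.ofReal_prod, ← Finset.prod_mul_distrib, ← Finset.prod_mul_distrib]
  refine Finset.prod_congr rfl fun k _ => ?_
  rw [← Complex.exp_conj, ← Complex.exp_add]
  congr 2
  simp only [map_mul, Complex.conj_ofReal, Complex.conj_I, map_ofNat, map_intCast]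
  ring

lemma truncKernel_nonneg (d : ℕ) (s : Finset ℤ) (v : (Fin d → unitInterval) →₀ ℂ) :
    0 ≤ (v.sum fun x w => v.sum fun x' w' =>
      (starRingEnd ℂ) (P.truncKernel d s x' x * w) * w').re := by
  set e : (Fin d → ℤ) → (Fin d → unitInterval) → ℂ := fun h x =>
    ∏ k, Complex.exp (2 * Real.pi * Complex.I * h k * ((x k : ℝ) : ℂ)) with he
  have key : (v.sum fun x w => v.sum fun x' w' =>
      (starRingEnd ℂ) (P.truncKernel d s x' x * w) * w') =
      ∑ h ∈ Fintype.piFinset fun _ : Fin d => s,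
        ((∏ k : Fin d, P.ω ^ (P.a k * |(h k : ℝ)| ^ P.b k) : ℝ) : ℂ) *
        ((Complex.normSq (∑ x ∈ v.support, e h x * (starRingEnd ℂ) (v x)) : ℝ) : ℂ) := by
    simp only [Finsupp.sum, truncKernel_eq]
    calc _ = ∑ x ∈ v.support, ∑ h ∈ Fintype.piFinset fun _ : Fin d => s, ∑ x' ∈ v.support,
          ((∏ k : Fin d, P.ω ^ (P.a k * |(h k : ℝ)| ^ P.b k) : ℝ) : ℂ) *
            ((e h x * (starRingEnd ℂ) (v x)) * ((starRingEnd ℂ) (e h x') * v x')) := by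
          refine Finset.sum_congr rfl fun x _ => ?_
          rw [Finset.sum_comm]
          refine Finset.sum_congr rfl fun x' _ => ?_
          rw [Finset.sum_mul, map_sum, Finset.sum_mul]
          refine Finset.sum_congr rfl fun h _ => ?_
          simp only [map_mul, Complex.conj_conj, Complex.conj_ofReal, he]
          ring
      _ = _ := by
          rw [Finset.sum_comm]
          refine Finset.sum_congr rfl fun h _ => ?_
          rw [← Complex.mul_conj, map_sum, Finset.sum_mul_sum, Finset.mul_sum]
          refine Finset.sum_congr rfl fun x _ => ?_
          rw [Finset.mul_sum]
          refine Finset.sum_congr rfl fun x' _ => ?_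
          rw [map_mul, Complex.conj_conj]
  rw [key, Complex.re_sum]
  refine Finset.sum_nonneg fun h _ => ?_
  rw [← Complex.ofReal_mul, Complex.ofReal_re]
  exact mul_nonneg (Finset.prod_nonneg fun k _ => Real.rpow_nonneg P.ω_pos.le _)
    (Complex.normSq_nonneg _)

lemma posSemidef_kernelMatrix (d : ℕ) : (P.kernelMatrix d).PosSemidef := by
  have htfae := (RKHS.posSemidef_tfae (K := P.kernelMatrix d)).out 0 2
  refine htfae.2 ⟨?_, fun v => ?_⟩
  · ext x y
    have h1 : star (ContinuousLinearMap.id ℂ ℂ) = ContinuousLinearMap.id ℂ ℂ :=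
      star_one (ℂ →L[ℂ] ℂ)
    simp [kernelMatrix, h1, conj_kernel]
  · have hlim : Tendsto (fun s => (v.sum fun x w => v.sum fun x' w' =>
        (starRingEnd ℂ) (P.truncKernel d s x' x * w) * w').re) atTop
        (𝓝 (v.sum fun x w => v.sum fun x' w' =>
        (starRingEnd ℂ) (P.kernel d x' x * w) * w').re) := by
      refine (Complex.continuous_re.tendsto _).comp ?_
      refine tendsto_finsetSum _ fun x _ => tendsto_finsetSum _ fun x' _ => ?_
      refine Tendsto.mul_const _ ?_
      refine (Complex.continuous_conj.tendsto _).comp ?_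
      exact (P.tendsto_truncKernel d x' x).mul_const _
    have := ge_of_tendsto' hlim fun s => P.truncKernel_nonneg d s v
    simpa [kernelMatrix, mul_comm] using this

instance (d : ℕ) : Fact (P.kernelMatrix d).PosSemidef := ⟨P.posSemidef_kernelMatrix d⟩

/-- The analytic Korobov space: the reproducing kernel Hilbert space of complex valued functions
on `[0, 1]^d` whose reproducing kernel is the analytic Korobov kernel. -/
def Space (d : ℕ) : Type := RKHS.OfKernel (P.kernelMatrix d)

instance (d : ℕ) : NormedAddCommGroup (P.Space d) :=
  inferInstanceAs (NormedAddCommGroup (RKHS.OfKernel (P.kernelMatrix d)))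

instance (d : ℕ) : InnerProductSpace ℂ (P.Space d) :=
  inferInstanceAs (InnerProductSpace ℂ (RKHS.OfKernel (P.kernelMatrix d)))

instance (d : ℕ) : CompleteSpace (P.Space d) :=
  inferInstanceAs (CompleteSpace (RKHS.OfKernel (P.kernelMatrix d)))

instance (d : ℕ) : RKHS ℂ (P.Space d) (Fin d → unitInterval) ℂ :=
  inferInstanceAs (RKHS ℂ (RKHS.OfKernel (P.kernelMatrix d)) (Fin d → unitInterval) ℂ)

/-- The reproducing kernel of the space is the analytic Korobov kernel. -/
lemma kernel_space (d : ℕ) : RKHS.kernel (P.Space d) = P.kernelMatrix d :=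
  RKHS.OfKernel.kernel_ofKernel (K := P.kernelMatrix d)

lemma norm_kernelMatrix (d : ℕ) (x y : Fin d → unitInterval) :
    ‖RKHS.kernel (P.Space d) x y‖ = ‖P.kernel d x y‖ := by
  rw [kernel_space]
  simp [kernelMatrix, norm_smul]

variable {P} in
lemma Space.norm_apply_le {d : ℕ} (f : P.Space d) (x : Fin d → unitInterval) :
    ‖f x‖ ≤ √‖P.kernel d 0 0‖ * ‖f‖ := by
  have := RKHS.norm_apply_le f x
  rwa [norm_kernelMatrix, P.kernel_self d x 0, mul_comm] at this

variable {P} in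
lemma Space.continuous {d : ℕ} (f : P.Space d) : Continuous fun x => f x := by
  rw [continuous_iff_continuousAt]
  intro y
  have hk : ∀ x z, inner ℂ (RKHS.kerFun (P.Space d) x 1) (RKHS.kerFun (P.Space d) z 1)
      = P.kernel d x z := by
    intro x z
    rw [RKHS.kerFun_inner, RKHS.kerFun_apply, kernel_space]
    simp [kernelMatrix]
  have hnorm : ∀ x, ‖RKHS.kerFun (P.Space d) x 1 - RKHS.kerFun (P.Space d) y 1‖ ^ 2
      = 2 * (P.kernel d y y).re - 2 * (P.kernel d x y).re := by
    intro x
    rw [@norm_sub_sq ℂ, ← @inner_self_eq_norm_sq ℂ, ← @inner_self_eq_norm_sq ℂ, hk, hk, hk,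
      P.kernel_self d x y]
    simp only [RCLike.re_to_complex]
    ring
  have hb : ∀ x, dist (f x) (f y) ≤
      √(2 * (P.kernel d y y).re - 2 * (P.kernel d x y).re) * ‖f‖ := by
    intro x
    rw [← hnorm, Real.sqrt_sq (norm_nonneg _), dist_eq_norm]
    have : f x - f y = inner ℂ (RKHS.kerFun (P.Space d) x 1 - RKHS.kerFun (P.Space d) y 1) f := by
      rw [inner_sub_left, RKHS.kerFun_inner, RKHS.kerFun_inner]
      simp
    rw [this]
    exact norm_inner_le_norm _ _
  have hcont : Continuous fun x =>
      √(2 * (P.kernel d y y).re - 2 * (P.kernel d x y).re) * ‖f‖ :=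
    ((continuous_const.sub (continuous_const.mul
      (Complex.continuous_re.comp (P.continuous_kernel d y)))).sqrt).mul continuous_const
  refine tendsto_iff_dist_tendsto_zero.2 ?_
  refine squeeze_zero (fun _ => dist_nonneg) hb ?_
  simpa using hcont.tendsto y

/-- The elements of the analytic Korobov space as continuous functions. -/
def toContinuousMap (d : ℕ) : P.Space d →L[ℂ] C(Fin d → unitInterval, ℂ) :=
  LinearMap.mkContinuous
    { toFun := fun f => ⟨fun x => f x, Space.continuous f⟩
      map_add' := fun f g => by ext x; simp
      map_smul' := fun c f => by ext x; simp }
    (√‖P.kernel d 0 0‖)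
    fun f => (ContinuousMap.norm_le _ (by positivity)).2 fun x => Space.norm_apply_le f x

/-- The approximation problem: the embedding `f ↦ f` of the analytic Korobov space into
`L₂([0, 1]^d)`. -/
def APP (d : ℕ) : P.Space d →L[ℂ] Lp ℂ 2 (volume : Measure (Fin d → unitInterval)) :=
  (ContinuousMap.toLp 2 volume ℂ) ∘L P.toContinuousMap d

lemma APP_ae_eq (d : ℕ) (f : P.Space d) :
    (P.APP d f : (Fin d → unitInterval) → ℂ) =ᵐ[volume] fun x => f x :=
  ContinuousMap.coeFn_toLp volume (P.toContinuousMap d f)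

/-- The information complexity `n(ε, APP_d)` for the criterion `X`. -/
def complexity (X : ErrorCriterion) (ε : ℝ) (d : ℕ) : ℕ∞ :=
  informationComplexity X (P.APP d) ε

/-- `A_* = liminf_{k → ∞} a_k ln ω⁻¹ / ln k`, in the extended reals (with the index shift of
`KorobovParameters`, `P.a k` is `a_{k+1}`). -/
def Astar : EReal :=
  liminf (fun k : ℕ => ((P.a k * Real.log P.ω⁻¹ / Real.log ((k : ℝ) + 1) : ℝ) : EReal)) atTop

end KorobovParameters

end

noncomputable section

/-! ### Diagonal operators between Hilbert spaces -/

section DiagonalOperator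

/-! The trigonometric functions diagonalise the embedding: suitably normalised they form a Hilbert
basis of the Korobov space (`hilbertBasis`), and `APP` sends them to multiples `√(eig h)` of an
orthonormal family in L₂. Hence the complexity is the number of frequencies `h` with `eig h > ε²`
(`complexity_le_card`, `card_le_complexity`). The largest singular value is 1, attained at `h = 0`,
so the two error criteria coincide.

Upper bounds come from a Chebyshev count: the number of such `h` is at most `ε^(-2τ) ∑ eig^τ`. The
sum factorises over coordinates and is bounded by the exponential of a constant times `∑ ω^(τ a_k)`
(`complexity_le`). A fixed `τ` with convergent series gives SPT; taking `τ` proportional to `1 + log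
d` gives QPT with no summability at all.

Lower bounds come from counting 0/1 frequencies with exactly `r` ones (`choose_le_complexity`). For
fixed `r` there are of order `d^r` of them, all seen at an accuracy about `ω^(r a_d / 2)`. Comparing
powers of `d` and letting `r` be large removes lower-order terms, including any factor `d^q`; so PT
already forces `A_* > 0` (`le_Astar_of_polynomial_bound`), and the QPT exponent is bounded below
(`le_of_QPTBound`). All weak notions follow from QPT (`IsSTWT.of_QPTBound`). -/

lemma Orthonormal.norm_sq_sum_smul {ι E : Type*} [NormedAddCommGroup E] [InnerProductSpace ℂ E]
    {v : ι → E} (hv : Orthonormal ℂ v) (c : ι → ℂ) (s : Finset ι) :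
    ‖∑ i ∈ s, c i • v i‖ ^ 2 = ∑ i ∈ s, ‖c i‖ ^ 2 := by
  have h := hv.inner_sum c c s
  rw [inner_self_eq_norm_sq_to_K] at h
  have h2 : ∀ i ∈ s, (starRingEnd ℂ) (c i) * c i = ((‖c i‖ ^ 2 : ℝ) : ℂ) := fun i _ => by
    rw [mul_comm, Complex.mul_conj, Complex.normSq_eq_norm_sq]
  rw [Finset.sum_congr rfl h2, ← Complex.ofReal_sum, ← RCLike.ofReal_pow] at h
  exact Complex.ofReal_injective h

variable {ι H G : Type*} [NormedAddCommGroup H] [InnerProductSpace ℂ H]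
  [NormedAddCommGroup G] [InnerProductSpace ℂ G]
  {T : H →L[ℂ] G} {v : HilbertBasis ι ℂ H} {E : ι → G} {σ : ι → ℝ}

lemma map_sum_smul_diagonal (hT : ∀ i, T (v i) = (σ i : ℂ) • E i) (c : ι → ℂ) (s : Finset ι) :
    T (∑ i ∈ s, c i • v i) = ∑ i ∈ s, (c i * σ i) • E i := by
  simp only [map_sum, map_smul, hT, smul_smul]

/-- Compare squared coefficients on finite partial sums of the basis expansion, then pass to the
limit by continuity. The disjunction serves both the initial error (all `σ i ≤ 1`) and residuals
orthogonal to the directions with large `σ i`. -/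
lemma norm_diagonal_apply_le (hE : Orthonormal ℂ E) (hσ : ∀ i, 0 ≤ σ i)
    (hT : ∀ i, T (v i) = (σ i : ℂ) • E i) {ε : ℝ} (hε : 0 ≤ ε) {g : H}
    (hg : ∀ i, inner ℂ (v i) g = 0 ∨ σ i ≤ ε) : ‖T g‖ ≤ ε * ‖g‖ := by
  have hs := v.hasSum_repr g
  have key : ∀ s : Finset ι, ‖T (∑ i ∈ s, v.repr g i • v i)‖ ≤
      ε * ‖∑ i ∈ s, v.repr g i • v i‖ := by
    intro s
    refine le_of_sq_le_sq ?_ (by positivity)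
    rw [map_sum_smul_diagonal hT, hE.norm_sq_sum_smul, mul_pow, v.orthonormal.norm_sq_sum_smul,
      Finset.mul_sum]
    refine Finset.sum_le_sum fun i _ => ?_
    rw [norm_mul, mul_pow, mul_comm, Complex.norm_real, Real.norm_of_nonneg (hσ i),
      v.repr_apply_apply]
    rcases hg i with h | h
    · simp [h]
    · have := hσ i
      gcongr
  exact le_of_tendsto_of_tendsto' ((T.continuous.norm.tendsto _).comp hs)
    (((continuous_norm.tendsto _).comp hs).const_mul ε) key

lemma minimalError_zero_diagonal (hE : Orthonormal ℂ E) (hσ : ∀ i, 0 ≤ σ i)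
    (hT : ∀ i, T (v i) = (σ i : ℂ) • E i) (hσ1 : ∀ i, σ i ≤ 1) {i₀ : ι} (hi₀ : σ i₀ = 1) :
    minimalError T 0 = 1 := by
  refine le_antisymm ?_ ?_
  · refine iSup₂_le fun f hf => ?_
    have h := norm_diagonal_apply_le hE hσ hT zero_le_one (g := f) fun i => Or.inr (hσ1 i)
    rw [mem_closedBall_zero_iff] at hf
    rw [← ofReal_norm, ENNReal.ofReal_le_one]
    linarith
  · refine le_trans ?_ (le_iSup₂ (v i₀) ?_)
    · rw [hT, hi₀]
      simp [enorm_eq_nnnorm, hE.nnnorm_eq_one]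
    · simp [v.orthonormal.norm_eq_one]

/-- The algorithm applies `T` to the orthogonal projection onto the span of the basis vectors in
`S`. Nonemptiness places `S.card` in the successor branch of `minimalError`. -/
lemma minimalError_diagonal_le (hE : Orthonormal ℂ E) (hσ : ∀ i, 0 ≤ σ i)
    (hT : ∀ i, T (v i) = (σ i : ℂ) • E i) {ε : ℝ} (hε : 0 ≤ ε) {S : Finset ι} (hS : S.Nonempty)
    (hSε : ∀ i, ε < σ i → i ∈ S) : minimalError T S.card ≤ ENNReal.ofReal ε := by
  obtain ⟨n, hn⟩ : ∃ n, S.card = n + 1 := Nat.exists_eq_succ_of_ne_zero hS.card_pos.ne'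
  set e : Fin (n + 1) ≃ S := (S.equivFinOfCardEq hn).symm with he
  rw [hn]
  let L : Fin (n + 1) → H →L[ℂ] ℂ := fun j => innerSL ℂ (v (e j))
  let φ : (Fin (n + 1) → ℂ) → G := fun c => ∑ j, c j • T (v (e j))
  have hφ : Measurable[inferInstance, borel G] φ := by
    have hc : Continuous φ := by fun_prop
    borelize G
    exact hc.measurable
  refine (iInf_le_of_le L (iInf₂_le φ hφ)).trans ?_
  refine iSup₂_le fun f hf => ?_
  set p : H := ∑ i ∈ S, inner ℂ (v i) f • v i with hp
  have hTp : φ (fun j => L j f) = T p := by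
    simp only [φ, L, hp, map_sum, map_smul, innerSL_apply_apply]
    rw [← Finset.sum_coe_sort S fun i => inner ℂ (v i) f • T (v i)]
    exact e.sum_comp fun i : S => inner ℂ (v i) f • T (v i)
  have horth : ∀ i ∈ S, inner ℂ (v i) (f - p) = 0 := fun i hi => by
    rw [inner_sub_right, hp, v.orthonormal.inner_right_sum _ hi, sub_self]
  have hpf : inner ℂ p (f - p) = 0 := by
    rw [hp, sum_inner]
    exact Finset.sum_eq_zero fun i hi => by rw [inner_smul_left, horth i hi, mul_zero]
  have hnorm : ‖f - p‖ ≤ 1 := by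
    rw [mem_closedBall_zero_iff] at hf
    have h := norm_add_sq_eq_norm_sq_add_norm_sq_of_inner_eq_zero p (f - p) hpf
    rw [add_sub_cancel] at h
    nlinarith [norm_nonneg (f - p), norm_nonneg f, norm_nonneg p]
  rw [hTp, ← map_sub, ← ofReal_norm]
  refine ENNReal.ofReal_le_ofReal ((norm_diagonal_apply_le hE hσ hT hε fun i => ?_).trans
    (mul_le_of_le_one_right hε hnorm))
  by_cases hi : i ∈ S
  · exact Or.inl (horth i hi)
  · exact Or.inr (not_lt.1 fun h => hi (hSε i h))

/-- Dimension count: `n` functionals have a common nonzero zero in the span of more than `n` basis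
vectors, and `T` shrinks norms there by at most the factor `δ`. -/
lemma exists_unit_vector_diagonal (hE : Orthonormal ℂ E)
    (hT : ∀ i, T (v i) = (σ i : ℂ) • E i) {δ : ℝ} (hδ : 0 ≤ δ) {S : Finset ι}
    (hS : ∀ i ∈ S, δ ≤ σ i) {n : ℕ} (hn : n < S.card) (L : Fin n → H →L[ℂ] ℂ) :
    ∃ f : H, ‖f‖ = 1 ∧ (∀ j, L j f = 0) ∧ δ ≤ ‖T f‖ := by
  classical
  let A : (S → ℂ) →ₗ[ℂ] (Fin n → ℂ) :=
    LinearMap.pi fun j => ∑ i : S, (LinearMap.proj i : (S → ℂ) →ₗ[ℂ] ℂ).smulRight (L j (v i))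
  have hA : ∀ c j, A c j = L j (∑ i : S, c i • v i) := by
    intro c j
    simp [A, map_sum]
  have hker : LinearMap.ker A ≠ ⊥ := LinearMap.ker_ne_bot_of_finrank_lt (by simpa using hn)
  obtain ⟨c, hc, hc0⟩ := Submodule.exists_mem_ne_zero_of_ne_bot hker
  have hvS : Orthonormal ℂ fun i : S => v i := v.orthonormal.comp _ Subtype.val_injective
  have hES : Orthonormal ℂ fun i : S => E i := hE.comp _ Subtype.val_injective
  set g : H := ∑ i : S, c i • v i with hg
  have hgn : ‖g‖ ^ 2 = ∑ i : S, ‖c i‖ ^ 2 := hvS.norm_sq_sum_smul c Finset.univ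
  have hTg : ‖T g‖ ^ 2 = ∑ i : S, ‖c i * σ i‖ ^ 2 := by
    rw [← hES.norm_sq_sum_smul (fun i : S => c i * σ i) Finset.univ, hg]
    simp only [map_sum, map_smul, hT, smul_smul]
  have hle : δ * ‖g‖ ≤ ‖T g‖ := by
    refine le_of_sq_le_sq ?_ (norm_nonneg _)
    rw [mul_pow, hgn, hTg, Finset.mul_sum]
    refine Finset.sum_le_sum fun i _ => ?_
    have hi := hS i i.2
    rw [norm_mul, mul_pow, mul_comm, Complex.norm_real, Real.norm_of_nonneg (hδ.trans hi)]
    gcongr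
  have hg0 : 0 < ‖g‖ := by
    obtain ⟨i, hi⟩ := Function.ne_iff.1 hc0
    have : 0 < ‖g‖ ^ 2 := by
      rw [hgn]
      exact Finset.sum_pos' (fun _ _ => by positivity)
        ⟨i, Finset.mem_univ _, by have := norm_pos_iff.2 hi; positivity⟩
    exact (norm_nonneg _).lt_of_ne fun h => by simp [← h] at this
  refine ⟨((‖g‖⁻¹ : ℝ) : ℂ) • g, ?_, fun j => ?_, ?_⟩
  · rw [norm_smul, Complex.norm_real, norm_inv, norm_norm, inv_mul_cancel₀ hg0.ne']
  · rw [map_smul, hg, ← hA, LinearMap.mem_ker.1 hc]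
    simp
  · rw [map_smul, norm_smul, Complex.norm_real, norm_inv, norm_norm, le_inv_mul_iff₀' hg0]
    exact hle

lemma le_minimalError_diagonal (hE : Orthonormal ℂ E)
    (hT : ∀ i, T (v i) = (σ i : ℂ) • E i) {δ : ℝ} (hδ : 0 ≤ δ) {S : Finset ι}
    (hS : ∀ i ∈ S, δ ≤ σ i) {n : ℕ} (hn : n < S.card) :
    ENNReal.ofReal δ ≤ minimalError T n := by
  cases n with
  | zero =>
    obtain ⟨f, hf, -, hTf⟩ := exists_unit_vector_diagonal hE hT hδ hS hn Fin.elim0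
    refine le_trans ?_ (le_iSup₂ f (by simp [hf]))
    rw [← ofReal_norm]
    exact ENNReal.ofReal_le_ofReal hTf
  | succ n =>
    refine le_iInf fun L => le_iInf₂ fun φ _ => ?_
    obtain ⟨f, hf, hL, hTf⟩ := exists_unit_vector_diagonal hE hT hδ hS hn L
    -- The vectors `f` and `-f` yield the same information 0, hence the same output `φ 0`; it misses
    -- one of `T f`, `-T f` by at least `‖T f‖`, whatever `φ` is.
    have hmem : ∀ g : H, ‖g‖ = 1 → (∀ j, L j g = 0) →
        ENNReal.ofReal ‖T g - φ 0‖ ≤ algorithmError T L φ := by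
      intro g hg hLg
      rw [ofReal_norm]
      have h0 : (0 : Fin (n + 1) → ℂ) = fun i => L i g := funext fun i => (hLg i).symm
      rw [h0]
      exact le_iSup₂ (f := fun f (_ : f ∈ Metric.closedBall (0 : H) 1) =>
        ‖T f - φ (fun i => L i f)‖ₑ) g (by simp [hg])
    have h1 := hmem f hf hL
    have h2 := hmem (-f) (by simpa using hf) (by simpa using hL)
    rcases le_total ‖T f - φ 0‖ ‖T (-f) - φ 0‖ with h | h
    all_goals
      have htri : 2 * ‖T f‖ ≤ ‖T f - φ 0‖ + ‖T (-f) - φ 0‖ := by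
        have := norm_sub_le (T f - φ 0) (T (-f) - φ 0)
        rw [map_neg, sub_sub_sub_cancel_right, sub_neg_eq_add, ← two_smul ℝ, norm_smul] at this
        simpa using this
    · exact le_trans (ENNReal.ofReal_le_ofReal (by linarith)) h2
    · exact le_trans (ENNReal.ofReal_le_ofReal (by linarith)) h1

lemma criterionScale_diagonal (hE : Orthonormal ℂ E) (hσ : ∀ i, 0 ≤ σ i)
    (hT : ∀ i, T (v i) = (σ i : ℂ) • E i) (hσ1 : ∀ i, σ i ≤ 1) {i₀ : ι} (hi₀ : σ i₀ = 1)
    (X : ErrorCriterion) : criterionScale X T = 1 := by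
  cases X
  · rfl
  · exact minimalError_zero_diagonal hE hσ hT hσ1 hi₀

lemma informationComplexity_le_card (hE : Orthonormal ℂ E) (hσ : ∀ i, 0 ≤ σ i)
    (hT : ∀ i, T (v i) = (σ i : ℂ) • E i) {X : ErrorCriterion} (hX : criterionScale X T = 1)
    {ε : ℝ} (hε : 0 ≤ ε) {S : Finset ι} (hS : S.Nonempty) (hSε : ∀ i, ε < σ i → i ∈ S) :
    informationComplexity X T ε ≤ S.card := by
  refine iInf₂_le (f := fun (n : ℕ) _ => (n : ℕ∞)) S.card ?_
  rw [hX, mul_one]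
  exact minimalError_diagonal_le hE hσ hT hε hS hSε

lemma card_le_informationComplexity (hE : Orthonormal ℂ E)
    (hT : ∀ i, T (v i) = (σ i : ℂ) • E i) {X : ErrorCriterion} (hX : criterionScale X T = 1)
    {ε : ℝ} (hε : 0 ≤ ε) {S : Finset ι} (hSε : ∀ i ∈ S, ε < σ i) :
    (S.card : ℕ∞) ≤ informationComplexity X T ε := by
  refine le_iInf₂ fun n hn => ?_
  rw [hX, mul_one] at hn
  by_contra! hlt
  have hlt' : n < S.card := by exact_mod_cast hlt
  have hne : S.Nonempty := Finset.card_pos.1 (by omega)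
  -- The minimum over the finite set is still strictly above `ε`, so the error bound contradicts
  -- `hn`.
  obtain ⟨i, hi, hmin⟩ := S.exists_min_image σ hne
  have h := (le_minimalError_diagonal hE hT (hε.trans (hSε i hi).le) hmin hlt').trans hn
  rw [ENNReal.ofReal_le_ofReal_iff hε] at h
  exact absurd (hSε i hi) (not_lt.2 h)

end DiagonalOperator

/-! ### The singular value decomposition of the approximation problem -/

/-- The univariate trigonometric function `x ↦ exp(2 π i n x)` on `[0, 1]`. -/
def trig₁ (n : ℤ) (x : unitInterval) : ℂ := Complex.exp (2 * Real.pi * Complex.I * n * ((x : ℝ) : ℂ))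

lemma continuous_trig₁ (n : ℤ) : Continuous (trig₁ n) := by
  unfold trig₁
  fun_prop

lemma conj_trig₁ (n : ℤ) (x : unitInterval) : (starRingEnd ℂ) (trig₁ n x) = trig₁ (-n) x := by
  unfold trig₁
  rw [← Complex.exp_conj]
  congr 1
  simp only [map_mul, Complex.conj_ofReal, Complex.conj_I, map_ofNat, map_intCast]
  push_cast
  ring

lemma trig₁_add (m n : ℤ) (x : unitInterval) : trig₁ (m + n) x = trig₁ m x * trig₁ n x := by
  unfold trig₁
  rw [← Complex.exp_add]
  push_cast
  ring_nf

lemma norm_trig₁ (n : ℤ) (x : unitInterval) : ‖trig₁ n x‖ = 1 := by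
  have : (2 * Real.pi * Complex.I * n * ((x : ℝ) : ℂ) : ℂ)
      = ((2 * Real.pi * n * (x : ℝ) : ℝ) : ℂ) * Complex.I := by
    push_cast; ring
  rw [trig₁, this, Complex.norm_exp_ofReal_mul_I]

lemma integral_trig₁ (n : ℤ) : ∫ x, trig₁ n x = if n = 0 then 1 else 0 := by
  split_ifs with h
  · simp [trig₁, h]
  · have h1 := unitInterval.measurePreserving_coe.integral_comp
      unitInterval.measurableEmbedding_coe
      (fun x : ℝ => Complex.exp (2 * Real.pi * Complex.I * n * x))
    have hc : (2 * Real.pi * Complex.I * n : ℂ) ≠ 0 := by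
      simp [Real.pi_ne_zero, h]
    unfold trig₁
    rw [h1, unitInterval, integral_Icc_eq_integral_Ioc,
      ← intervalIntegral.integral_of_le zero_le_one, integral_exp_mul_complex hc]
    have h2 : Complex.exp (2 * Real.pi * Complex.I * n * (1 : ℝ)) = 1 := by
      rw [Complex.exp_eq_one_iff]
      exact ⟨n, by push_cast; ring⟩
    rw [h2]
    simp

lemma integral_conj_trig₁_mul (m n : ℤ) :
    ∫ x, (starRingEnd ℂ) (trig₁ m x) * trig₁ n x = if m = n then 1 else 0 := by
  simp_rw [conj_trig₁, ← trig₁_add, integral_trig₁]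
  congr 1
  rw [eq_iff_iff]
  omega

lemma korobovKernel₁_eq (ω a b : ℝ) (x y : unitInterval) :
    korobovKernel₁ ω a b x y = ∑' h : ℤ, ((ω ^ (a * |(h : ℝ)| ^ b) : ℝ) : ℂ) *
      (trig₁ h x * (starRingEnd ℂ) (trig₁ h y)) := by
  unfold korobovKernel₁
  refine tsum_congr fun h => ?_
  rw [conj_trig₁, trig₁, trig₁, ← Complex.exp_add]
  congr 2
  push_cast
  ring

/-- Absolute summability allows integrating term by term, and orthogonality leaves only the
frequency `m`. -/
lemma integral_korobovKernel₁_mul {ω a b : ℝ} (hω : 0 < ω) (hω1 : ω < 1) (ha : 0 < a)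
    (hb : 0 < b) (m : ℤ) (x : unitInterval) :
    ∫ y, korobovKernel₁ ω a b x y * trig₁ m y =
      ((ω ^ (a * |(m : ℝ)| ^ b) : ℝ) : ℂ) * trig₁ m x := by
  set F : ℤ → unitInterval → ℂ := fun h y => ((ω ^ (a * |(h : ℝ)| ^ b) : ℝ) : ℂ) *
      trig₁ h x * ((starRingEnd ℂ) (trig₁ h y) * trig₁ m y) with hF
  have hcont : ∀ h, Continuous (F h) := fun h =>
    continuous_const.mul ((Complex.continuous_conj.comp (continuous_trig₁ h)).mul
      (continuous_trig₁ m))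
  have hnorm : ∀ h y, ‖F h y‖ = ω ^ (a * |(h : ℝ)| ^ b) := fun h y => by
    simp only [hF, norm_mul, RCLike.norm_conj, norm_trig₁, mul_one, Complex.norm_real,
      Real.norm_of_nonneg (Real.rpow_nonneg hω.le _)]
  have hint : ∀ h, Integrable (F h) := fun h =>
    (hcont h).integrable_of_hasCompactSupport (HasCompactSupport.of_compactSpace _)
  have hsum : Summable fun h => ∫ y, ‖F h y‖ := by
    simpa [hnorm] using summable_korobov hω hω1 ha hb
  have h1 := integral_tsum_of_summable_integral_norm hint hsum
  calc ∫ y, korobovKernel₁ ω a b x y * trig₁ m y = ∫ y, ∑' h, F h y := by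
        refine integral_congr_ae (ae_of_all _ fun y => ?_)
        simp only [korobovKernel₁_eq, ← tsum_mul_right, hF]
        exact tsum_congr fun h => by ring
    _ = ∑' h, ∫ y, F h y := h1.symm
    _ = _ := by
        rw [tsum_eq_single m]
        · simp only [hF, integral_const_mul, integral_conj_trig₁_mul]
          simp
        · intro h hne
          simp only [hF, integral_const_mul, integral_conj_trig₁_mul]
          simp [hne]

/-- The multivariate trigonometric function `x ↦ exp(2 π i h · x)` on `[0, 1]^d`. -/
def trig {d : ℕ} (h : Fin d → ℤ) : C(Fin d → unitInterval, ℂ) where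
  toFun x := ∏ k, trig₁ (h k) (x k)
  continuous_toFun := continuous_finsetProd _ fun k _ =>
    (continuous_trig₁ (h k)).comp (continuous_apply k)

lemma trig_apply {d : ℕ} (h : Fin d → ℤ) (x : Fin d → unitInterval) :
    trig h x = ∏ k, trig₁ (h k) (x k) := rfl

lemma norm_trig_apply {d : ℕ} (h : Fin d → ℤ) (x : Fin d → unitInterval) : ‖trig h x‖ = 1 := by
  rw [trig_apply, norm_prod]
  exact Finset.prod_eq_one fun k _ => norm_trig₁ _ _

/-- The trigonometric functions as elements of `L₂([0, 1]^d)`. -/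
def trigLp {d : ℕ} (h : Fin d → ℤ) : Lp ℂ 2 (volume : Measure (Fin d → unitInterval)) :=
  ContinuousMap.toLp 2 volume ℂ (trig h)

lemma orthonormal_trigLp (d : ℕ) : Orthonormal ℂ (trigLp (d := d)) := by
  classical
  rw [orthonormal_iff_ite]
  intro m n
  rw [trigLp, trigLp, ContinuousMap.inner_toLp]
  have h1 : ∀ x : Fin d → unitInterval, trig n x * (starRingEnd ℂ) (trig m x) =
      ∏ k, (starRingEnd ℂ) (trig₁ (m k) (x k)) * trig₁ (n k) (x k) := fun x => by
    rw [trig_apply, trig_apply, map_prod, ← Finset.prod_mul_distrib]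
    exact Finset.prod_congr rfl fun k _ => mul_comm _ _
  simp_rw [h1]
  rw [integral_fintype_prod_volume_eq_prod
    (fun k y => (starRingEnd ℂ) (trig₁ (m k) y) * trig₁ (n k) y)]
  simp_rw [integral_conj_trig₁_mul]
  split_ifs with h
  · simp [h]
  · obtain ⟨i, hi⟩ := Function.ne_iff.1 h
    exact Finset.prod_eq_zero (Finset.mem_univ i) (if_neg hi)

/-! ### Eigenvalues and the trigonometric Hilbert basis of the Korobov space -/

namespace KorobovParameters

variable (P : KorobovParameters)

/-- The eigenvalues of the integral operator with the analytic Korobov kernel. -/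
def eig {d : ℕ} (h : Fin d → ℤ) : ℝ := ∏ k : Fin d, P.ω ^ (P.a k * |(h k : ℝ)| ^ P.b k)

lemma eig_pos {d : ℕ} (h : Fin d → ℤ) : 0 < P.eig h :=
  Finset.prod_pos fun _ _ => Real.rpow_pos_of_pos P.ω_pos _

lemma eig_le_one {d : ℕ} (h : Fin d → ℤ) : P.eig h ≤ 1 :=
  Finset.prod_le_one (fun _ _ => Real.rpow_nonneg P.ω_pos.le _) fun k _ =>
    Real.rpow_le_one P.ω_pos.le P.ω_lt_one.le
      (mul_nonneg (P.a_pos k).le (Real.rpow_nonneg (abs_nonneg _) _))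

lemma eig_zero (d : ℕ) : P.eig (0 : Fin d → ℤ) = 1 :=
  Finset.prod_eq_one fun k _ => by simp [Real.zero_rpow (P.b_pos k).ne']

lemma integral_kernel_mul_trig {d : ℕ} (h : Fin d → ℤ) (x : Fin d → unitInterval) :
    ∫ y, P.kernel d x y * trig h y = P.eig h * trig h x := by
  simp_rw [kernel, trig_apply, ← Finset.prod_mul_distrib]
  rw [integral_fintype_prod_volume_eq_prod
    (fun (k : Fin d) y => korobovKernel₁ P.ω (P.a k) (P.b k) (x k) y * trig₁ (h k) y)]
  simp_rw [integral_korobovKernel₁_mul P.ω_pos P.ω_lt_one (P.a_pos _) (P.b_pos _)]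
  rw [Finset.prod_mul_distrib, eig, Complex.ofReal_prod]

/-- The image of a trigonometric function under the adjoint of the embedding. -/
def adjointTrig {d : ℕ} (h : Fin d → ℤ) : P.Space d :=
  ContinuousLinearMap.adjoint (P.APP d) (trigLp h)

/-- The element of the Korobov space representing the evaluation at a point. -/
def evalVec {d : ℕ} (x : Fin d → unitInterval) : P.Space d := RKHS.kerFun (P.Space d) x 1

lemma evalVec_apply {d : ℕ} (x y : Fin d → unitInterval) : P.evalVec x y = P.kernel d y x := by
  rw [evalVec, RKHS.kerFun_apply, kernel_space]
  simp [kernelMatrix]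

lemma inner_evalVec {d : ℕ} (x : Fin d → unitInterval) (f : P.Space d) :
    inner ℂ (P.evalVec x) f = f x := by
  rw [evalVec, RKHS.kerFun_inner]
  simp

/-- Pairing with `evalVec x` and moving the adjoint across turns the value at `x` into the kernel
integral. Defining the vector through the adjoint makes membership in the Korobov space automatic.
-/
lemma adjointTrig_apply {d : ℕ} (h : Fin d → ℤ) (x : Fin d → unitInterval) :
    P.adjointTrig h x = P.eig h * trig h x := by
  rw [← inner_evalVec, adjointTrig, ContinuousLinearMap.adjoint_inner_right, APP, trigLp,
    ContinuousLinearMap.comp_apply, ContinuousMap.inner_toLp, ← integral_kernel_mul_trig]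
  refine integral_congr_ae (ae_of_all _ fun y => ?_)
  have : P.toContinuousMap d (P.evalVec x) y = P.kernel d y x := P.evalVec_apply x y
  simp only [this, conj_kernel]
  ring

lemma APP_adjointTrig {d : ℕ} (h : Fin d → ℤ) :
    P.APP d (P.adjointTrig h) = (P.eig h : ℂ) • trigLp h := by
  have : P.toContinuousMap d (P.adjointTrig h) = (P.eig h : ℂ) • trig h := by
    ext x
    exact P.adjointTrig_apply h x
  rw [APP, ContinuousLinearMap.comp_apply, this, map_smul, trigLp]

/-- The normalized trigonometric functions in the Korobov space. -/
def basisVec {d : ℕ} (h : Fin d → ℤ) : P.Space d := ((√(P.eig h))⁻¹ : ℂ) • P.adjointTrig h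

lemma sqrt_eig_ne_zero {d : ℕ} (h : Fin d → ℤ) : (√(P.eig h) : ℂ) ≠ 0 := by
  have := Real.sqrt_pos.2 (P.eig_pos h)
  exact_mod_cast this.ne'

lemma sqrt_eig_mul_self {d : ℕ} (h : Fin d → ℤ) : (√(P.eig h) : ℂ) * √(P.eig h) = P.eig h := by
  exact_mod_cast Real.mul_self_sqrt (P.eig_pos h).le

lemma basisVec_apply {d : ℕ} (h : Fin d → ℤ) (x : Fin d → unitInterval) :
    P.basisVec h x = √(P.eig h) * trig h x := by
  rw [basisVec, RKHS.coe_smul, Pi.smul_apply, adjointTrig_apply, smul_eq_mul,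
    ← P.sqrt_eig_mul_self]
  field_simp [P.sqrt_eig_ne_zero h]

lemma APP_basisVec {d : ℕ} (h : Fin d → ℤ) :
    P.APP d (P.basisVec h) = (√(P.eig h) : ℂ) • trigLp h := by
  rw [basisVec, map_smul, APP_adjointTrig, smul_smul, ← P.sqrt_eig_mul_self]
  congr 1
  field_simp [P.sqrt_eig_ne_zero h]

lemma orthonormal_basisVec (d : ℕ) : Orthonormal ℂ (P.basisVec (d := d)) := by
  classical
  rw [orthonormal_iff_ite]
  intro m n
  rw [basisVec, inner_smul_left, adjointTrig, ContinuousLinearMap.adjoint_inner_left,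
    APP_basisVec, inner_smul_right, orthonormal_iff_ite.1 (orthonormal_trigLp d)]
  split_ifs with h
  · rw [h, mul_one, map_inv₀, Complex.conj_ofReal, inv_mul_cancel₀ (P.sqrt_eig_ne_zero n)]
  · simp

lemma norm_sq_inner_basisVec_evalVec {d : ℕ} (h : Fin d → ℤ) (x : Fin d → unitInterval) :
    ‖inner ℂ (P.basisVec h) (P.evalVec x)‖ ^ 2 = P.eig h := by
  rw [norm_inner_symm, inner_evalVec, basisVec_apply, norm_mul, norm_trig_apply, mul_one,
    Complex.norm_real, Real.norm_of_nonneg (Real.sqrt_nonneg _), Real.sq_sqrt (P.eig_pos h).le]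

lemma truncKernel_self (d : ℕ) (s : Finset ℤ) (x : Fin d → unitInterval) :
    P.truncKernel d s x x = ((∑ h ∈ Fintype.piFinset fun _ : Fin d => s, P.eig h : ℝ) : ℂ) := by
  rw [truncKernel_eq, Complex.ofReal_sum]
  refine Finset.sum_congr rfl fun h _ => ?_
  have h1 : (∏ k, Complex.exp (2 * Real.pi * Complex.I * h k * ((x k : ℝ) : ℂ))) = trig h x := rfl
  rw [h1, Complex.mul_conj, Complex.normSq_eq_norm_sq, norm_trig_apply, eig]
  simp

lemma tendsto_sum_eig (d : ℕ) (x : Fin d → unitInterval) :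
    Tendsto (fun s : Finset ℤ => ∑ h ∈ Fintype.piFinset fun _ : Fin d => s, P.eig h) atTop
      (𝓝 (‖P.evalVec x‖ ^ 2)) := by
  have h1 : P.kernel d x x = ((‖P.evalVec x‖ ^ 2 : ℝ) : ℂ) := by
    rw [← P.evalVec_apply x x, ← inner_evalVec, inner_self_eq_norm_sq_to_K]
    simp
  have h2 := (Complex.continuous_re.tendsto _).comp (P.tendsto_truncKernel d x x)
  rw [h1] at h2
  refine h2.congr fun s => ?_
  simp only [Function.comp, truncKernel_self, Complex.ofReal_re]

/-- The squared coefficients of `evalVec x` are the numbers `eig h`, whose sum is `K(x, x) =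
‖evalVec x‖²`. By Parseval `evalVec x` is a limit of elements of the span, so a `g` orthogonal to
the span vanishes at every `x`. -/
lemma span_basisVec_orthogonal (d : ℕ) :
    (Submodule.span ℂ (Set.range (P.basisVec (d := d))))ᗮ = ⊥ := by
  rw [Submodule.eq_bot_iff]
  intro g hg
  have hg' : ∀ h, inner ℂ (P.basisVec h) g = 0 := fun h =>
    Submodule.inner_right_of_mem_orthogonal (Submodule.subset_span (Set.mem_range_self h)) hg
  refine RKHS.ext fun x => ?_
  set p : Finset ℤ → P.Space d := fun s => ∑ h ∈ Fintype.piFinset fun _ : Fin d => s,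
    inner ℂ (P.basisVec h) (P.evalVec x) • P.basisVec h with hp
  have hnorm : ∀ s, ‖P.evalVec x - p s‖ ^ 2 = ‖P.evalVec x‖ ^ 2 -
      ∑ h ∈ Fintype.piFinset fun _ : Fin d => s, P.eig h := by
    intro s
    have horth : inner ℂ (p s) (P.evalVec x - p s) = 0 := by
      rw [hp, sum_inner]
      refine Finset.sum_eq_zero fun i hi => ?_
      rw [inner_smul_left, inner_sub_right, (P.orthonormal_basisVec d).inner_right_sum _ hi,
        sub_self, mul_zero]
    have h := norm_add_sq_eq_norm_sq_add_norm_sq_of_inner_eq_zero _ _ horth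
    have h2 := (P.orthonormal_basisVec d).norm_sq_sum_smul
      (fun h => inner ℂ (P.basisVec h) (P.evalVec x)) (Fintype.piFinset fun _ : Fin d => s)
    simp_rw [norm_sq_inner_basisVec_evalVec] at h2
    rw [add_sub_cancel] at h
    rw [← h2]
    simp only [hp] at h ⊢
    linarith
  have hbound : ∀ s, ‖g x‖ ≤ √(‖P.evalVec x‖ ^ 2 -
      ∑ h ∈ Fintype.piFinset fun _ : Fin d => s, P.eig h) * ‖g‖ := by
    intro s
    rw [← hnorm, Real.sqrt_sq (norm_nonneg _)]
    have h0 : inner ℂ (p s) g = 0 := by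
      rw [hp, sum_inner]
      exact Finset.sum_eq_zero fun h _ => by rw [inner_smul_left, hg', mul_zero]
    have : g x = inner ℂ (P.evalVec x - p s) g := by
      rw [inner_sub_left, h0, sub_zero, inner_evalVec]
    rw [this]
    exact norm_inner_le_norm _ _
  have hlim := (((tendsto_const_nhds (x := ‖P.evalVec x‖ ^ 2)).sub
    (P.tendsto_sum_eig d x)).sqrt).mul_const ‖g‖
  have := ge_of_tendsto' hlim hbound
  rw [sub_self, Real.sqrt_zero, zero_mul] at this
  simpa using this

/-- The Hilbert basis of the Korobov space formed by the normalized trigonometric functions. -/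
def hilbertBasis (d : ℕ) : HilbertBasis (Fin d → ℤ) ℂ (P.Space d) :=
  HilbertBasis.mkOfOrthogonalEqBot (P.orthonormal_basisVec d) (P.span_basisVec_orthogonal d)

lemma APP_hilbertBasis {d : ℕ} (h : Fin d → ℤ) :
    P.APP d (P.hilbertBasis d h) = ((√(P.eig h) : ℝ) : ℂ) • trigLp h := by
  rw [hilbertBasis, HilbertBasis.coe_mkOfOrthogonalEqBot, APP_basisVec]

lemma criterionScale_APP (X : ErrorCriterion) (d : ℕ) : criterionScale X (P.APP d) = 1 :=
  criterionScale_diagonal (orthonormal_trigLp d) (fun _ => Real.sqrt_nonneg _)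
    P.APP_hilbertBasis (fun h => Real.sqrt_le_one.2 (P.eig_le_one h))
    (i₀ := 0) (by rw [eig_zero, Real.sqrt_one]) X

lemma complexity_le_card (X : ErrorCriterion) {ε : ℝ} (hε : 0 ≤ ε) {d : ℕ}
    {S : Finset (Fin d → ℤ)} (hS : S.Nonempty) (hSε : ∀ h, ε ^ 2 < P.eig h → h ∈ S) :
    P.complexity X ε d ≤ S.card :=
  informationComplexity_le_card (orthonormal_trigLp d) (fun _ => Real.sqrt_nonneg _)
    P.APP_hilbertBasis (P.criterionScale_APP X d) hε hS
    fun h hh => hSε h ((Real.lt_sqrt hε).1 hh)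

lemma card_le_complexity (X : ErrorCriterion) {ε : ℝ} (hε : 0 ≤ ε) {d : ℕ}
    {S : Finset (Fin d → ℤ)} (hSε : ∀ h ∈ S, ε ^ 2 < P.eig h) :
    (S.card : ℕ∞) ≤ P.complexity X ε d :=
  card_le_informationComplexity (orthonormal_trigLp d)
    P.APP_hilbertBasis (P.criterionScale_APP X d) hε
    fun h hh => (Real.lt_sqrt hε).2 (hSε h hh)

end KorobovParameters

/-! ### Bounds for the information complexity -/

lemma summable_exp_neg_mul_abs_rpow {c b : ℝ} (hc : 0 < c) (hb : 0 < b) :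
    Summable fun h : ℤ => Real.exp (-(c * |(h : ℝ)| ^ b)) := by
  refine (summable_korobov (Real.exp_pos (-c)) (Real.exp_lt_one_iff.2 (by linarith)) one_pos hb).congr
    fun h => ?_
  rw [← Real.exp_mul]
  ring_nf

/-- The constant in `sum_exp_neg_mul_abs_rpow_le`. -/
def expTailConst (c b : ℝ) : ℝ := Real.exp c * ∑' h : ℤ, Real.exp (-(c * |(h : ℝ)| ^ b))

lemma expTailConst_nonneg (c b : ℝ) : 0 ≤ expTailConst c b :=
  mul_nonneg (Real.exp_pos _).le (tsum_nonneg fun _ => (Real.exp_pos _).le)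

/-- For `h ≠ 0` one has `|h| ≥ 1`, hence `c|h|^b ≥ (c - c₀) + c₀|h|^b₀`; the term `h = 0` gives the
1. The constant does not depend on `c` or `b`. -/
lemma sum_exp_neg_mul_abs_rpow_le {c₀ c b₀ b : ℝ} (hc₀ : 0 < c₀) (hc : c₀ ≤ c) (hb₀ : 0 < b₀)
    (hb : b₀ ≤ b) (s : Finset ℤ) :
    ∑ h ∈ s, Real.exp (-(c * |(h : ℝ)| ^ b)) ≤ 1 + expTailConst c₀ b₀ * Real.exp (-c) := by
  have hterm : ∀ h : ℤ, Real.exp (-(c * |(h : ℝ)| ^ b)) ≤ (if h = 0 then 1 else 0) +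
      Real.exp (-c) * Real.exp c₀ * Real.exp (-(c₀ * |(h : ℝ)| ^ b₀)) := by
    intro h
    split_ifs with h0
    · have : Real.exp (-(c * |(h : ℝ)| ^ b)) ≤ 1 := by
        rw [Real.exp_le_one_iff]
        have : 0 ≤ c * |(h : ℝ)| ^ b := by
          have := hc₀.le.trans hc
          positivity
        linarith
      have : 0 ≤ Real.exp (-c) * Real.exp c₀ * Real.exp (-(c₀ * |(h : ℝ)| ^ b₀)) := by positivity
      linarith
    · have h1 : (1 : ℝ) ≤ |(h : ℝ)| := by
        exact_mod_cast Int.one_le_abs h0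
      have h2 : |(h : ℝ)| ^ b₀ ≤ |(h : ℝ)| ^ b := Real.rpow_le_rpow_of_exponent_le h1 hb
      have h3 : 1 ≤ |(h : ℝ)| ^ b₀ := Real.one_le_rpow h1 hb₀.le
      rw [zero_add, ← Real.exp_add, ← Real.exp_add]
      refine Real.exp_le_exp.2 ?_
      nlinarith
  refine (Finset.sum_le_sum fun h _ => hterm h).trans ?_
  rw [Finset.sum_add_distrib, ← Finset.mul_sum]
  refine add_le_add ?_ ?_
  · rw [Finset.sum_ite_eq']
    split_ifs <;> norm_num
  · have := (summable_exp_neg_mul_abs_rpow hc₀ hb₀).sum_le_tsum s fun _ _ => (Real.exp_pos _).le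
    calc _ ≤ Real.exp (-c) * Real.exp c₀ * ∑' h : ℤ, Real.exp (-(c₀ * |(h : ℝ)| ^ b₀)) := by
          gcongr
      _ = _ := by rw [expTailConst]; ring

lemma exp_mul_log_div_le_choose {n r : ℕ} (hn : 1 ≤ n) (hr : 2 * r ≤ n) :
    Real.exp (r * Real.log n) / (2 ^ r * r.factorial) ≤ n.choose r := by
  have h := Nat.pow_le_choose (α := ℝ) r n
  refine le_trans ?_ h
  have hn' : (0 : ℝ) < n := by exact_mod_cast hn
  have h1 : (n : ℝ) / 2 ≤ ((n + 1 - r : ℕ) : ℝ) := by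
    have : n ≤ 2 * (n + 1 - r) := by omega
    have : (n : ℝ) ≤ 2 * ((n + 1 - r : ℕ) : ℝ) := by exact_mod_cast this
    linarith
  rw [Real.exp_nat_mul, Real.exp_log hn', ← div_div, ← div_pow]
  gcongr

namespace KorobovParameters

variable (P : KorobovParameters)

lemma log_inv_ω_pos : 0 < Real.log P.ω⁻¹ :=
  Real.log_pos ((one_lt_inv₀ P.ω_pos).2 P.ω_lt_one)

lemma ω_rpow (x : ℝ) : P.ω ^ x = Real.exp (-(Real.log P.ω⁻¹ * x)) := by
  rw [Real.rpow_def_of_pos P.ω_pos, Real.log_inv]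
  ring_nf

lemma eig_rpow {d : ℕ} (h : Fin d → ℤ) (τ : ℝ) :
    P.eig h ^ τ = ∏ k : Fin d,
      Real.exp (-(τ * (Real.log P.ω⁻¹ * P.a k) * |(h k : ℝ)| ^ P.b k)) := by
  rw [eig, ← Real.finsetProd_rpow _ _ fun _ _ => Real.rpow_nonneg P.ω_pos.le _]
  refine Finset.prod_congr rfl fun k _ => ?_
  rw [ω_rpow, ← Real.exp_mul]
  ring_nf

/-- The constant in `sum_eig_rpow_le`. -/
def eigConst (c : ℝ) : ℝ := expTailConst c (⨅ k, P.b k)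

lemma eigConst_nonneg (c : ℝ) : 0 ≤ P.eigConst c := expTailConst_nonneg _ _

/-- Enlarge `F` to a box, factorise, and use `1 + x ≤ exp x` in each coordinate. The constant sees
`τ` only through the lower bound `c`, so `τ` may later grow with `d`. -/
lemma sum_eig_rpow_le {τ c : ℝ} (hτ : 0 ≤ τ) (hc : 0 < c) (hcτ : c ≤ τ * (Real.log P.ω⁻¹ * P.a 0))
    {d : ℕ} (F : Finset (Fin d → ℤ)) :
    ∑ h ∈ F, P.eig h ^ τ ≤ Real.exp (P.eigConst c *
      ∑ k ∈ Finset.range d, Real.exp (-(τ * (Real.log P.ω⁻¹ * P.a k)))) := by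
  classical
  set s : Fin d → Finset ℤ := fun k => F.image fun h => h k with hs
  have hF : F ⊆ Fintype.piFinset s := fun h hh =>
    Fintype.mem_piFinset.2 fun k => Finset.mem_image_of_mem _ hh
  have hL := P.log_inv_ω_pos
  have hfac : ∀ k : Fin d, ∑ n ∈ s k,
      Real.exp (-(τ * (Real.log P.ω⁻¹ * P.a k) * |(n : ℝ)| ^ P.b k)) ≤
      Real.exp (P.eigConst c * Real.exp (-(τ * (Real.log P.ω⁻¹ * P.a k)))) := by
    intro k
    have hca : c ≤ τ * (Real.log P.ω⁻¹ * P.a k) := hcτ.trans (by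
      have := P.a_mono (Nat.zero_le k)
      gcongr)
    have hbk : ⨅ k, P.b k ≤ P.b k := ciInf_le ⟨0, by rintro _ ⟨j, rfl⟩; exact (P.b_pos j).le⟩ _
    refine (sum_exp_neg_mul_abs_rpow_le hc hca P.b_inf_pos hbk (s k)).trans ?_
    rw [add_comm]
    exact Real.add_one_le_exp _
  calc ∑ h ∈ F, P.eig h ^ τ ≤ ∑ h ∈ Fintype.piFinset s, P.eig h ^ τ :=
        Finset.sum_le_sum_of_subset_of_nonneg hF fun h _ _ => Real.rpow_nonneg (P.eig_pos h).le _
    _ = ∏ k : Fin d, ∑ n ∈ s k,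
          Real.exp (-(τ * (Real.log P.ω⁻¹ * P.a k) * |(n : ℝ)| ^ P.b k)) := by
        rw [Finset.prod_univ_sum]
        exact Finset.sum_congr rfl fun h _ => P.eig_rpow h τ
    _ ≤ ∏ k : Fin d, Real.exp (P.eigConst c * Real.exp (-(τ * (Real.log P.ω⁻¹ * P.a k)))) :=
        Finset.prod_le_prod (fun k _ => Finset.sum_nonneg fun _ _ => (Real.exp_pos _).le)
          fun k _ => hfac k
    _ = _ := by
        rw [← Real.exp_sum, ← Finset.mul_sum,
          Fin.sum_univ_eq_sum_range (fun k => Real.exp (-(τ * (Real.log P.ω⁻¹ * P.a k)))) d]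

lemma complexity_le (X : ErrorCriterion) {ε τ c : ℝ} (hε : ε ∈ Set.Ioo (0 : ℝ) 1) (hτ : 0 ≤ τ)
    (hc : 0 < c) (hcτ : c ≤ τ * (Real.log P.ω⁻¹ * P.a 0)) (d : ℕ) :
    (P.complexity X ε d : ℝ≥0∞) ≤ ENNReal.ofReal (Real.exp (P.eigConst c *
      ∑ k ∈ Finset.range d, Real.exp (-(τ * (Real.log P.ω⁻¹ * P.a k)))) * ε⁻¹ ^ (2 * τ)) := by
  set B := Real.exp (P.eigConst c *
      ∑ k ∈ Finset.range d, Real.exp (-(τ * (Real.log P.ω⁻¹ * P.a k)))) with hB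
  have hε0 := hε.1
  have hcard : ∀ F : Finset (Fin d → ℤ), (∀ h ∈ F, ε ^ 2 < P.eig h) →
      (F.card : ℝ) ≤ B * ε⁻¹ ^ (2 * τ) := by
    intro F hF
    have h1 : F.card • (ε ^ 2) ^ τ ≤ ∑ h ∈ F, P.eig h ^ τ :=
      Finset.card_nsmul_le_sum _ _ _ fun h hh =>
        Real.rpow_le_rpow (by positivity) (hF h hh).le hτ
    have h2 := h1.trans (P.sum_eig_rpow_le hτ hc hcτ F)
    have h3 : ε⁻¹ ^ (2 * τ) = ((ε ^ 2) ^ τ)⁻¹ := by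
      rw [Real.inv_rpow hε0.le, Real.rpow_mul hε0.le, Real.rpow_ofNat]
    rw [h3, ← div_eq_mul_inv, le_div_iff₀ (by positivity)]
    rwa [nsmul_eq_mul] at h2
  -- The cardinality bound is uniform over finite subsets, which forces finiteness.
  have hfin : {h : Fin d → ℤ | ε ^ 2 < P.eig h}.Finite := by
    by_contra hinf
    obtain ⟨n, hn⟩ := exists_nat_gt (B * ε⁻¹ ^ (2 * τ))
    obtain ⟨F, hF, hFn⟩ := Set.Infinite.exists_subset_card_eq hinf n
    have := hcard F fun h hh => hF hh
    rw [hFn] at this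
    linarith
  have hne : hfin.toFinset.Nonempty := ⟨0, by
    have : ε ^ 2 < 1 := by nlinarith [hε.1, hε.2]
    simpa [eig_zero] using this⟩
  have h1 := P.complexity_le_card X hε0.le hne fun h hh => by simpa using hh
  have h2 := hcard hfin.toFinset fun h hh => by simpa using hh
  calc (P.complexity X ε d : ℝ≥0∞) ≤ ((hfin.toFinset.card : ℕ∞) : ℝ≥0∞) := by exact_mod_cast h1
    _ = ENNReal.ofReal (hfin.toFinset.card : ℝ) := by simp
    _ ≤ _ := ENNReal.ofReal_le_ofReal h2

lemma one_le_complexity (X : ErrorCriterion) {ε : ℝ} (hε : ε ∈ Set.Ioo (0 : ℝ) 1) (d : ℕ) :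
    1 ≤ P.complexity X ε d := by
  have h := P.card_le_complexity X hε.1.le (S := {(0 : Fin d → ℤ)}) fun h hh => by
    rw [Finset.mem_singleton.1 hh, eig_zero]
    nlinarith [hε.1, hε.2]
  simpa using h

/-- Indicator vectors of `r`-subsets of the `d + 1` coordinates have eigenvalue at least `ω^(r
a_d)`, since `a d` is the largest weight involved; the exponents `b` play no role at 0 and 1. -/
lemma choose_le_complexity (X : ErrorCriterion) {ε : ℝ} (hε : 0 ≤ ε) (d r : ℕ)
    (hεr : ε ^ 2 < Real.exp (-(Real.log P.ω⁻¹ * (r * P.a d)))) :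
    ((d + 1).choose r : ℕ∞) ≤ P.complexity X ε (d + 1) := by
  classical
  set ind : Finset (Fin (d + 1)) → (Fin (d + 1) → ℤ) := fun s k => if k ∈ s then 1 else 0 with hind
  have hinj : Function.Injective ind := by
    intro s t hst
    ext k
    have := congrFun hst k
    simp only [hind] at this
    by_cases h1 : k ∈ s <;> by_cases h2 : k ∈ t <;> simp_all
  have h := P.card_le_complexity X hε
    (S := (Finset.powersetCard r (Finset.univ : Finset (Fin (d + 1)))).image ind) ?_
  · rw [Finset.card_image_of_injective _ hinj, Finset.card_powersetCard, Finset.card_univ,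
      Fintype.card_fin] at h
    exact h
  · intro h hh
    obtain ⟨s, hs, rfl⟩ := Finset.mem_image.1 hh
    have hsr := (Finset.mem_powersetCard.1 hs).2
    refine hεr.trans_le ?_
    have h1 : P.eig (ind s) = ∏ k ∈ s, P.ω ^ P.a k := by
      rw [eig, ← Finset.prod_subset (Finset.subset_univ s)]
      · exact Finset.prod_congr rfl fun k hk => by simp [hind, hk]
      · intro k _ hk
        simp [hind, hk, Real.zero_rpow (P.b_pos k).ne']
    calc Real.exp (-(Real.log P.ω⁻¹ * (r * P.a d))) = ∏ _k ∈ s, P.ω ^ P.a d := by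
          rw [Finset.prod_const, hsr, ω_rpow, ← Real.exp_nat_mul]
          ring_nf
      _ ≤ ∏ k ∈ s, P.ω ^ P.a k := by
          refine Finset.prod_le_prod (fun k _ => Real.rpow_nonneg P.ω_pos.le _) fun k _ => ?_
          exact Real.rpow_le_rpow_of_exponent_ge P.ω_pos P.ω_lt_one.le
            (P.a_mono (Nat.lt_succ_iff.1 k.2))
      _ = _ := h1.symm

/-- An upper bound for the complexity at a suitable threshold forces this inequality between the
logarithms. -/
lemma log_le_of_complexity_le (X : ErrorCriterion) {d r : ℕ} (hr : 2 * r ≤ d + 1) {Y : ℝ}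
    (hY : (P.complexity X (Real.exp (-(1 + Real.log P.ω⁻¹ * (r * P.a d) / 2))) (d + 1) : ℝ≥0∞) ≤
      ENNReal.ofReal (Real.exp Y)) :
    r * Real.log (d + 1 : ℕ) - Real.log (2 ^ r * r.factorial) ≤ Y := by
  -- The extra 1 in the exponent makes the threshold strict and keeps it below 1 even for `r = 0`.
  have hlt : Real.exp (-(1 + Real.log P.ω⁻¹ * (r * P.a d) / 2)) ^ 2 <
      Real.exp (-(Real.log P.ω⁻¹ * (r * P.a d))) := by
    rw [← Real.exp_nat_mul]
    refine Real.exp_lt_exp.2 ?_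
    push_cast
    linarith
  have h1 := P.choose_le_complexity X (Real.exp_pos _).le d r hlt
  have h2 : (((d + 1).choose r : ℕ∞) : ℝ≥0∞) ≤ ENNReal.ofReal (Real.exp Y) :=
    le_trans (by exact_mod_cast h1) hY
  have h3 : (((d + 1).choose r : ℕ) : ℝ) ≤ Real.exp Y := by
    rw [← ENNReal.ofReal_le_ofReal_iff (Real.exp_pos _).le]
    simpa using h2
  have h4 := (exp_mul_log_div_le_choose (Nat.succ_pos d) hr).trans h3
  rw [div_le_iff₀ (by positivity)] at h4
  have h5 := Real.log_le_log (Real.exp_pos _) h4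
  rw [Real.log_exp, Real.log_mul (Real.exp_pos _).ne' (by positivity), Real.log_exp] at h5
  linarith

lemma exp_neg_mem_Ioo (d r : ℕ) :
    Real.exp (-(1 + Real.log P.ω⁻¹ * (r * P.a d) / 2)) ∈ Set.Ioo (0 : ℝ) 1 := by
  refine ⟨Real.exp_pos _, Real.exp_lt_one_iff.2 ?_⟩
  have h1 := P.log_inv_ω_pos
  have h2 := P.a_pos d
  have : 0 ≤ Real.log P.ω⁻¹ * (r * P.a d) / 2 := by positivity
  linarith

end KorobovParameters

/-! ### Quasi-polynomial tractability implies weak tractability -/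

lemma one_add_log_le_mul_rpow {γ x : ℝ} (hγ : 0 < γ) (hx : 1 ≤ x) :
    1 + Real.log x ≤ (1 + γ⁻¹) * x ^ γ := by
  have h1 := Real.log_le_rpow_div (zero_le_one.trans hx) hγ
  have h2 := Real.one_le_rpow hx hγ.le
  rw [div_eq_inv_mul] at h1
  linarith

/-- The larger of `ε⁻¹` and `d` is at least half their sum, and both are at least 1, so the exponent
`min α β` serves for either. -/
lemma tendsto_rpow_add_rpow_jointLimit {α β : ℝ} (hα : 0 < α) (hβ : 0 < β) :
    Tendsto (fun q : ℝ × ℕ => q.1⁻¹ ^ α + (q.2 : ℝ) ^ β) jointLimit atTop := by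
  have h1 : Tendsto (fun q : ℝ × ℕ => q.1⁻¹ + (q.2 : ℝ)) jointLimit atTop :=
    tendsto_comap.mono_left inf_le_left
  have h2 := (tendsto_rpow_atTop (lt_min hα hβ)).comp (h1.atTop_div_const (two_pos))
  refine tendsto_atTop_mono' _ ?_ h2
  have hmem : ∀ᶠ q : ℝ × ℕ in jointLimit, q.1 ∈ Set.Ioo (0 : ℝ) 1 ∧ 1 ≤ q.2 :=
    mem_inf_of_right (mem_principal_self _)
  filter_upwards [hmem] with q hq
  have hx : 1 ≤ q.1⁻¹ := (one_le_inv₀ hq.1.1).2 hq.1.2.le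
  have hd : (1 : ℝ) ≤ q.2 := by exact_mod_cast hq.2
  have hα' : q.1⁻¹ ^ min α β ≤ q.1⁻¹ ^ α := Real.rpow_le_rpow_of_exponent_le hx (min_le_left _ _)
  have hβ' : (q.2 : ℝ) ^ min α β ≤ (q.2 : ℝ) ^ β :=
    Real.rpow_le_rpow_of_exponent_le hd (min_le_right _ _)
  have hm : 0 ≤ min α β := (lt_min hα hβ).le
  simp only [Function.comp]
  rcases le_total q.1⁻¹ (q.2 : ℝ) with h | h
  · have := Real.rpow_le_rpow (z := min α β) (x := (q.1⁻¹ + (q.2 : ℝ)) / 2) (y := q.2)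
      (by linarith) (by linarith) hm
    have h0 : 0 ≤ q.1⁻¹ ^ α := by positivity
    linarith
  · have := Real.rpow_le_rpow (z := min α β) (x := (q.1⁻¹ + (q.2 : ℝ)) / 2) (y := q.1⁻¹)
      (by linarith) (by linarith) hm
    have h0 : 0 ≤ (q.2 : ℝ) ^ β := by positivity
    linarith

/-- Each logarithmic factor is at most a constant times `S^(1/4)`; their product costs `S^(1/2)`,
leaving decay `S^(-1/2)`. -/
lemma log_bound_le_rpow {α β t c x y : ℝ} (hα : 0 < α) (hβ : 0 < β) (ht : 0 ≤ t)
    (hc : 0 ≤ c) (hx : 1 ≤ x) (hy : 1 ≤ y) :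
    (c + t * (1 + Real.log y) * (1 + Real.log x)) / (x ^ α + y ^ β) ≤
      (c + t * (1 + (β / 4)⁻¹) * (1 + (α / 4)⁻¹)) * (x ^ α + y ^ β) ^ (-(1 / 2) : ℝ) := by
  set S := x ^ α + y ^ β with hS
  have hx0 : 0 ≤ x := zero_le_one.trans hx
  have hy0 : 0 ≤ y := zero_le_one.trans hy
  have hxα : 1 ≤ x ^ α := Real.one_le_rpow hx hα.le
  have hyβ : 1 ≤ y ^ β := Real.one_le_rpow hy hβ.le
  have hS1 : 1 ≤ S := by linarith
  have hS0 : 0 < S := by linarith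
  have h1 : x ^ (α / 4) ≤ S ^ (1 / 4 : ℝ) := by
    rw [div_eq_mul_one_div, Real.rpow_mul hx0]
    exact Real.rpow_le_rpow (by linarith) (by linarith) (by norm_num)
  have h2 : y ^ (β / 4) ≤ S ^ (1 / 4 : ℝ) := by
    rw [div_eq_mul_one_div, Real.rpow_mul hy0]
    exact Real.rpow_le_rpow (by linarith) (by linarith) (by norm_num)
  have h3 := one_add_log_le_mul_rpow (by positivity : 0 < α / 4) hx
  have h4 := one_add_log_le_mul_rpow (by positivity : 0 < β / 4) hy
  have hlx := Real.log_nonneg hx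
  have h5 : t * (1 + Real.log y) * (1 + Real.log x) ≤
      t * ((1 + (β / 4)⁻¹) * S ^ (1 / 4 : ℝ)) * ((1 + (α / 4)⁻¹) * S ^ (1 / 4 : ℝ)) := by
    gcongr
    · exact h4.trans (by gcongr)
    · exact h3.trans (by gcongr)
  have h6 : S ^ (1 / 4 : ℝ) * S ^ (1 / 4 : ℝ) = S ^ (1 / 2 : ℝ) := by
    rw [← Real.rpow_add hS0]; norm_num
  have h7 : S ^ (-(1 / 2) : ℝ) * S = S ^ (1 / 2 : ℝ) := by
    nth_rewrite 2 [← Real.rpow_one S]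
    rw [← Real.rpow_add hS0]; norm_num
  have h8 : 1 ≤ S ^ (1 / 2 : ℝ) := Real.one_le_rpow hS1 (by norm_num)
  rw [div_le_iff₀ hS0, mul_assoc _ _ S, h7]
  calc c + t * (1 + Real.log y) * (1 + Real.log x)
      ≤ c * S ^ (1 / 2 : ℝ) + t * ((1 + (β / 4)⁻¹) * S ^ (1 / 4 : ℝ)) *
          ((1 + (α / 4)⁻¹) * S ^ (1 / 4 : ℝ)) := add_le_add (le_mul_of_one_le_right hc h8) h5
    _ = _ := by rw [← h6]; ring

lemma IsSTWT.of_QPTBound {N : ℝ → ℕ → ℕ∞}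
    (hN : ∀ d : ℕ, 1 ≤ d → ∀ ε ∈ Set.Ioo (0 : ℝ) 1, 1 ≤ N ε d) {t₀ : ℝ} (ht₀ : 0 < t₀)
    (h : QPTBound N t₀) {s t : ℝ} (hs : 0 < s) (ht : 0 < t) : IsSTWT N s t := by
  obtain ⟨C, hC, hb⟩ := h
  have hmem : ∀ᶠ q : ℝ × ℕ in jointLimit, q.1 ∈ Set.Ioo (0 : ℝ) 1 ∧ 1 ≤ q.2 :=
    mem_inf_of_right (mem_principal_self _)
  set c := max (Real.log C) 0 with hc
  set K := c + t₀ * (1 + (t / 4)⁻¹) * (1 + (s / 4)⁻¹) with hK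
  have hlim : Tendsto (fun q : ℝ × ℕ =>
      ((K * (q.1⁻¹ ^ s + (q.2 : ℝ) ^ t) ^ (-(1 / 2) : ℝ) : ℝ) : EReal)) jointLimit (𝓝 0) := by
    have h1 := ((tendsto_rpow_neg_atTop (by norm_num : (0 : ℝ) < 1 / 2)).comp
      (tendsto_rpow_add_rpow_jointLimit hs ht)).const_mul K
    rw [mul_zero] at h1
    exact (continuous_coe_real_ereal.tendsto 0).comp h1
  refine tendsto_of_tendsto_of_tendsto_of_le_of_le' tendsto_const_nhds hlim ?_ ?_
  · filter_upwards [hmem] with q hq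
    have h1 := hN q.2 hq.2 q.1 hq.1
    have hε := hq.1.1
    refine EReal.div_nonneg ?_ ?_
    · rw [ENNReal.zero_le_log_iff]
      exact_mod_cast h1
    · exact_mod_cast (by positivity : (0 : ℝ) ≤ q.1⁻¹ ^ s + (q.2 : ℝ) ^ t)
  · filter_upwards [hmem] with q hq
    have hε := hq.1.1
    have hx : 1 ≤ q.1⁻¹ := (one_le_inv₀ hq.1.1).2 hq.1.2.le
    have hd : (1 : ℝ) ≤ q.2 := by exact_mod_cast hq.2
    have h1 := ENNReal.log_monotone (hb q.2 hq.2 q.1 hq.1)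
    rw [ENNReal.log_ofReal_of_pos (by positivity), Real.log_mul hC.ne' (Real.exp_pos _).ne',
      Real.log_exp] at h1
    have hS : (0 : ℝ) ≤ q.1⁻¹ ^ s + (q.2 : ℝ) ^ t := by positivity
    refine (EReal.div_le_div_right_of_nonneg (by exact_mod_cast hS) h1).trans ?_
    rw [← EReal.coe_div, EReal.coe_le_coe_iff]
    refine le_trans ?_ (log_bound_le_rpow hs ht ht₀.le (le_max_right (Real.log C) 0) hx hd)
    gcongr
    exact le_max_left _ _

lemma IsSPT.isPT {N : ℝ → ℕ → ℕ∞} (h : IsSPT N) : IsPT N := by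
  obtain ⟨p, hp, C, hC, hb⟩ := h
  exact ⟨C, p, 0, hC, hp, le_rfl, fun d hd ε hε => by
    rw [Real.rpow_zero, mul_one]
    exact hb d hd ε hε⟩

lemma eventually_lt_mul_log_succ {c K : ℝ} (hc : 0 < c) :
    ∀ᶠ d : ℕ in atTop, K < c * Real.log (d + 1 : ℕ) :=
  ((Real.tendsto_log_atTop.comp ((tendsto_natCast_atTop_atTop (R := ℝ)).comp
    (tendsto_add_atTop_nat 1))).const_mul_atTop hc).eventually_gt_atTop K

namespace KorobovParameters

variable (P : KorobovParameters)

/-! ### Tractability bounds for analytic Korobov spaces -/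

lemma SPTBound_complexity (X : ErrorCriterion) {s : ℝ} (hs : 0 < s)
    (hsum : Summable fun k => Real.exp (-(s * (Real.log P.ω⁻¹ * P.a k)))) :
    SPTBound (P.complexity X) (2 * s) := by
  have hL := P.log_inv_ω_pos
  have ha := P.a_pos 0
  refine ⟨Real.exp (P.eigConst (s * (Real.log P.ω⁻¹ * P.a 0)) *
    ∑' k, Real.exp (-(s * (Real.log P.ω⁻¹ * P.a k)))), (Real.exp_pos _).le, fun d _ ε hε => ?_⟩
  refine (P.complexity_le X hε hs.le (by positivity) le_rfl d).trans
    (ENNReal.ofReal_le_ofReal ?_)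
  have h1 := hsum.sum_le_tsum (Finset.range d) fun _ _ => (Real.exp_pos _).le
  have h2 := P.eigConst_nonneg (s * (Real.log P.ω⁻¹ * P.a 0))
  have hε0 := hε.1
  gcongr

/-- Eventually `a_k ln ω⁻¹ > y ln (k + 1)`, so the terms are dominated by `(k + 1)^(-s y)`. -/
lemma summable_of_lt_Astar {s y : ℝ} (hs : 0 < s) (hsy : 1 < s * y) (hy : (y : EReal) < P.Astar) :
    Summable fun k => Real.exp (-(s * (Real.log P.ω⁻¹ * P.a k))) := by
  have hsumm : Summable fun k : ℕ => ((k : ℝ) + 1) ^ (-(s * y)) := by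
    have h := (summable_nat_add_iff 1).2 (Real.summable_nat_rpow.2 (by linarith : -(s * y) < -1))
    simpa using h
  refine Summable.of_norm_bounded_eventually_nat hsumm ?_
  filter_upwards [eventually_lt_of_lt_liminf hy, eventually_ge_atTop 1] with k hk hk1
  rw [EReal.coe_lt_coe_iff] at hk
  have hk1' : (1 : ℝ) ≤ k := by exact_mod_cast hk1
  have hlog : 0 < Real.log ((k : ℝ) + 1) := Real.log_pos (by linarith)
  rw [lt_div_iff₀ hlog] at hk
  rw [Real.norm_of_nonneg (Real.exp_pos _).le, Real.rpow_def_of_pos (by linarith)]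
  refine Real.exp_le_exp.2 ?_
  nlinarith

lemma SPTBound_of_lt_Astar (X : ErrorCriterion) {z : ℝ} (hz : 0 < z)
    (h : ((2 / z : ℝ) : EReal) < P.Astar) : SPTBound (P.complexity X) z := by
  obtain ⟨y, hy1, hy2⟩ := EReal.lt_iff_exists_real_btwn.1 h
  rw [EReal.coe_lt_coe_iff, div_lt_iff₀ hz] at hy1
  have := P.SPTBound_complexity X (half_pos hz)
    (P.summable_of_lt_Astar (half_pos hz) (by linarith) hy2)
  rwa [mul_div_cancel₀ z two_ne_zero] at this

/-- If `A_* < y`, then `a_d ln ω⁻¹ < y ln (d + 1)` for infinitely many `d`. For those, the binomial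
lower bound has order `(d + 1)^r`, while the assumed bound has order at most `(d + 1)^(q + p r y /
2)`. -/
lemma le_Astar_of_polynomial_bound (X : ErrorCriterion) {C p q y : ℝ} (hp : 0 ≤ p)
    (hb : ∀ d : ℕ, 1 ≤ d → ∀ ε ∈ Set.Ioo (0 : ℝ) 1,
      (P.complexity X ε d : ℝ≥0∞) ≤ ENNReal.ofReal (C * (d : ℝ) ^ q * ε⁻¹ ^ p))
    (hpy : p * y / 2 < 1) : (y : EReal) ≤ P.Astar := by
  by_contra! hlt
  have hfreq := frequently_lt_of_liminf_lt (h := hlt)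
  -- This `r` satisfies `r > q + p r y / 2`: since `p y / 2 < 1`, a large `r` absorbs `q`.
  obtain ⟨r, hr⟩ := exists_nat_gt (q / (1 - p * y / 2))
  rw [div_lt_iff₀ (by linarith)] at hr
  have hr' : 0 < r - q - p * r * y / 2 := by linarith
  set C' := max C 1 with hC'
  have hC'0 : 0 < C' := lt_max_of_lt_right one_pos
  obtain ⟨d, hd, hd1, hd2⟩ := (hfreq.and_eventually ((eventually_ge_atTop (2 * r + 1)).and
    (eventually_lt_mul_log_succ hr' (K := Real.log (2 ^ r * r.factorial) + Real.log C' + p)))).exists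
  have hd0 : (1 : ℝ) ≤ d := by exact_mod_cast (by omega : 1 ≤ d)
  have hcast : ((d + 1 : ℕ) : ℝ) = (d : ℝ) + 1 := by push_cast; ring
  have hlog : 0 < Real.log (d + 1 : ℕ) := Real.log_pos (by rw [hcast]; linarith)
  rw [EReal.coe_lt_coe_iff, ← hcast, div_lt_iff₀ hlog] at hd
  have hε := P.exp_neg_mem_Ioo d r
  have h1 := P.log_le_of_complexity_le X (d := d) (r := r) (by omega)
    (Y := Real.log C' + q * Real.log (d + 1 : ℕ) +
      p * (1 + Real.log P.ω⁻¹ * (r * P.a d) / 2)) ?_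
  · have h2 : p * r * (P.a d * Real.log P.ω⁻¹) ≤ p * r * (y * Real.log (d + 1 : ℕ)) := by
      gcongr
    linarith
  · refine (hb (d + 1) (by omega) _ hε).trans (ENNReal.ofReal_le_ofReal ?_)
    rw [Real.exp_add, Real.exp_add, Real.exp_log hC'0, ← Real.exp_neg, neg_neg, ← Real.exp_mul,
      Real.rpow_def_of_pos (by rw [hcast]; linarith), mul_comm q, mul_comm p]
    gcongr
    exact le_max_left _ _

lemma Astar_pos_of_isPT (X : ErrorCriterion) (h : IsPT (P.complexity X)) : 0 < P.Astar := by
  obtain ⟨C, p, q, -, hp, -, hb⟩ := h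
  have h1 := P.le_Astar_of_polynomial_bound X (y := (p + 1)⁻¹) hp hb (by
    have : p * (p + 1)⁻¹ < 1 := by
      rw [← div_eq_mul_inv, div_lt_one (by positivity)]
      linarith
    linarith)
  refine lt_of_lt_of_le ?_ h1
  exact_mod_cast (by positivity : (0 : ℝ) < (p + 1)⁻¹)

lemma isSPT_of_Astar_pos (X : ErrorCriterion) (h : 0 < P.Astar) : IsSPT (P.complexity X) := by
  obtain ⟨y, hy1, hy2⟩ := EReal.lt_iff_exists_real_btwn.1 h
  have hy : 0 < y := by exact_mod_cast hy1
  refine ⟨2 / y, by positivity, P.SPTBound_of_lt_Astar X (by positivity) ?_⟩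
  rwa [div_div_cancel₀ two_ne_zero]

lemma exponentSPT_eq (X : ErrorCriterion) (h : 0 < P.Astar) :
    exponentSPT (P.complexity X) = 2 / P.Astar := by
  refine le_antisymm ?_ (le_iInf₂ fun p hp => ?_)
  · refine EReal.le_of_forall_lt_iff_le.1 fun z hz => ?_
    have hz0 : 0 < z := by
      have : (0 : EReal) < z := (EReal.div_nonneg zero_le_two h.le).trans_lt hz
      exact_mod_cast this
    refine iInf₂_le z ⟨hz0.le, P.SPTBound_of_lt_Astar X hz0 ?_⟩
    generalize P.Astar = A at h hz
    induction A with
    | bot => simp at h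
    | top => exact EReal.coe_lt_top _
    | coe A =>
      have hA : 0 < A := by exact_mod_cast h
      have h2 : ((2 / A : ℝ) : EReal) < z := by rwa [EReal.coe_div]
      rw [EReal.coe_lt_coe_iff, div_lt_iff₀ hA] at h2
      rw [EReal.coe_lt_coe_iff, div_lt_iff₀ hz0]
      linarith
  · obtain ⟨hp, C, hC, hb⟩ := hp
    have hle : ∀ y : ℝ, p * y / 2 < 1 → (y : EReal) ≤ P.Astar := fun y hy =>
      P.le_Astar_of_polynomial_bound X (q := 0) (C := C) hp (fun d hd ε hε => by
        rw [Real.rpow_zero, mul_one]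
        exact hb d hd ε hε) hy
    generalize P.Astar = A at h hle
    induction A with
    | bot => simp at h
    | top =>
      rw [EReal.div_top]
      exact_mod_cast hp
    | coe A =>
      have hA : 0 < A := by exact_mod_cast h
      have h2 : ((2 / A : ℝ) : EReal) ≤ p := by
        rw [EReal.coe_le_coe_iff, div_le_iff₀ hA]
        by_contra! hlt
        have hpA : 0 ≤ p * A := by positivity
        -- With `p A < 2`, this witness exceeds `A` yet still satisfies `p y / 2 < 1`.
        have h3 := hle (A * (2 / (1 + p * A / 2))) (by
          have : p * (A * (2 / (1 + p * A / 2))) / 2 = p * A / (1 + p * A / 2) := by ring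
          rw [this, div_lt_one (by positivity)]
          linarith)
        rw [EReal.coe_le_coe_iff] at h3
        have h4 : 1 < 2 / (1 + p * A / 2) := by
          rw [one_lt_div (by positivity)]
          linarith
        nlinarith
      rwa [EReal.coe_div] at h2

/-- Use `complexity_le` with `τ = s (1 + log d)`. Each index `k ≥ k₀` then contributes at most `1/d`
and each earlier one at most 1, so the sum over `k < d` stays below `k₀ + 1` for every `d`. -/
lemma QPTBound_complexity (X : ErrorCriterion) {s : ℝ} (hs : 0 < s) {k₀ : ℕ}
    (hk : ∀ k, k₀ ≤ k → 1 ≤ s * (Real.log P.ω⁻¹ * P.a k)) :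
    QPTBound (P.complexity X) (2 * s) := by
  have hL := P.log_inv_ω_pos
  have ha := P.a_pos 0
  set c := s * (Real.log P.ω⁻¹ * P.a 0) with hc
  have hM := P.eigConst_nonneg c
  refine ⟨Real.exp (P.eigConst c * (k₀ + 1)), Real.exp_pos _, fun d hd ε hε => ?_⟩
  have hε0 := hε.1
  have hd1 : (1 : ℝ) ≤ d := by exact_mod_cast hd
  have hlog := Real.log_nonneg hd1
  have hlogε : 0 ≤ Real.log ε⁻¹ := Real.log_nonneg ((one_le_inv₀ hε.1).2 hε.2.le)
  have hcτ : c ≤ s * (1 + Real.log d) * (Real.log P.ω⁻¹ * P.a 0) := by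
    rw [hc]
    gcongr
    exact le_mul_of_one_le_right hs.le (by linarith)
  refine (P.complexity_le X hε (by positivity) (by positivity) hcτ d).trans
    (ENNReal.ofReal_le_ofReal ?_)
  have hterm : ∀ k : ℕ, Real.exp (-(s * (1 + Real.log d) * (Real.log P.ω⁻¹ * P.a k))) ≤
      (if k < k₀ then 1 else 0) + (d : ℝ)⁻¹ := by
    intro k
    have hak := P.a_pos k
    split_ifs with hk'
    · have : Real.exp (-(s * (1 + Real.log d) * (Real.log P.ω⁻¹ * P.a k))) ≤ 1 := by
        rw [Real.exp_le_one_iff]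
        have : 0 ≤ s * (1 + Real.log d) * (Real.log P.ω⁻¹ * P.a k) := by positivity
        linarith
      have : 0 ≤ (d : ℝ)⁻¹ := by positivity
      linarith
    · have h1 := hk k (not_lt.1 hk')
      rw [zero_add, ← Real.exp_log (by positivity : 0 < (d : ℝ)⁻¹), Real.log_inv (d : ℝ)]
      refine Real.exp_le_exp.2 ?_
      nlinarith
  have hsum : ∑ k ∈ Finset.range d,
      Real.exp (-(s * (1 + Real.log d) * (Real.log P.ω⁻¹ * P.a k))) ≤ k₀ + 1 := by
    refine (Finset.sum_le_sum fun k _ => hterm k).trans ?_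
    rw [Finset.sum_add_distrib]
    refine add_le_add ?_ ?_
    · rw [Finset.sum_boole]
      have : ((Finset.range d).filter fun k => k < k₀) ⊆ Finset.range k₀ := fun k hk => by
        simpa using (Finset.mem_filter.1 hk).2
      have := Finset.card_le_card this
      rw [Finset.card_range] at this
      exact_mod_cast this
    · rw [Finset.sum_const, Finset.card_range, nsmul_eq_mul, mul_inv_cancel₀ (by positivity)]
  refine mul_le_mul (by gcongr) ?_ (by positivity) (Real.exp_pos _).le
  rw [Real.rpow_def_of_pos (by positivity)]
  refine Real.exp_le_exp.2 ?_
  have : 0 ≤ 2 * s * (1 + Real.log d) := by positivity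
  linarith

/-- With bounded weights the threshold for a fixed `r` is bounded below independently of `d`.
Comparing coefficients of `log d` requires `r ≤ t (2 + r a ln ω⁻¹ / 2)` for every `r`; dividing by
`r → ∞` gives the claim. -/
lemma le_of_QPTBound (X : ErrorCriterion) {t a : ℝ} (ht : 0 < t) (ha : ∀ k, P.a k ≤ a)
    (h : QPTBound (P.complexity X) t) : 2 ≤ t * (Real.log P.ω⁻¹ * a) := by
  obtain ⟨C, hC, hb⟩ := h
  have hL := P.log_inv_ω_pos
  by_contra! hlt
  obtain ⟨r, hr⟩ := exists_nat_gt (2 * t / (1 - t * (Real.log P.ω⁻¹ * a) / 2))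
  rw [div_lt_iff₀ (by linarith)] at hr
  -- The 2 adds the 1 in the QPT factor `1 + ln ε⁻¹` to the 1 in the threshold exponent.
  set u := t * (2 + Real.log P.ω⁻¹ * (r * a) / 2) with hu
  have hr' : 0 < r - u := by rw [hu]; linarith
  obtain ⟨d, hd1, hd2⟩ := ((eventually_ge_atTop (2 * r + 1)).and (eventually_lt_mul_log_succ hr'
    (K := Real.log (2 ^ r * r.factorial) + Real.log C + u))).exists
  have hd0 : (1 : ℝ) ≤ (d + 1 : ℕ) := by exact_mod_cast (by omega : 1 ≤ d + 1)
  have hlog := Real.log_nonneg hd0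
  have hε := P.exp_neg_mem_Ioo d r
  have h1 := P.log_le_of_complexity_le X (d := d) (r := r) (by omega)
    (Y := Real.log C + t * (1 + Real.log (d + 1 : ℕ)) *
      (1 + (1 + Real.log P.ω⁻¹ * (r * P.a d) / 2))) ?_
  · have h2 : t * (1 + Real.log (d + 1 : ℕ)) * (1 + (1 + Real.log P.ω⁻¹ * (r * P.a d) / 2)) ≤
        t * (1 + Real.log (d + 1 : ℕ)) * (1 + (1 + Real.log P.ω⁻¹ * (r * a) / 2)) := by
      have := ha d
      gcongr
    have h3 : t * (1 + Real.log (d + 1 : ℕ)) * (1 + (1 + Real.log P.ω⁻¹ * (r * a) / 2)) =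
        u + u * Real.log (d + 1 : ℕ) := by rw [hu]; ring
    linarith
  · refine (hb (d + 1) (by omega) _ hε).trans (ENNReal.ofReal_le_ofReal ?_)
    rw [Real.exp_add, Real.exp_log hC, ← Real.exp_neg, neg_neg, Real.log_exp]

lemma tendsto_a : Tendsto (fun k : ℕ => (P.a k : EReal)) atTop (𝓝 (⨆ k, (P.a k : EReal))) :=
  tendsto_atTop_iSup fun _ _ h => EReal.coe_le_coe_iff.2 (P.a_mono h)

lemma QPTBound_of_lt_iSup (X : ErrorCriterion) {z : ℝ} (hz : 0 < z)
    (h : ((2 / (z * Real.log P.ω⁻¹) : ℝ) : EReal) < ⨆ k, (P.a k : EReal)) :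
    QPTBound (P.complexity X) z := by
  obtain ⟨k₀, hk₀⟩ := lt_iSup_iff.1 h
  have hL := P.log_inv_ω_pos
  rw [EReal.coe_lt_coe_iff, div_lt_iff₀ (by positivity)] at hk₀
  have := P.QPTBound_complexity X (half_pos hz) (k₀ := k₀) fun k hk => by
    have := P.a_mono hk
    have : z / 2 * (Real.log P.ω⁻¹ * P.a k₀) ≤ z / 2 * (Real.log P.ω⁻¹ * P.a k) := by gcongr
    linarith
  rwa [mul_div_cancel₀ z two_ne_zero] at this

lemma exists_QPTBound (X : ErrorCriterion) : ∃ t : ℝ, 0 < t ∧ QPTBound (P.complexity X) t := by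
  have hL := P.log_inv_ω_pos
  have ha := P.a_pos 0
  refine ⟨2 * (Real.log P.ω⁻¹ * P.a 0)⁻¹, by positivity,
    P.QPTBound_complexity X (by positivity) (k₀ := 0) fun k _ => ?_⟩
  rw [inv_mul_eq_div, one_le_div (by positivity)]
  have := P.a_mono (Nat.zero_le k)
  gcongr

/-- When the weights are unbounded every `t > 0` is admissible and the infimum is 0; the matching
lower bound `le_of_QPTBound` is needed only for a finite limit. -/
lemma exponentQPT_eq (X : ErrorCriterion) : exponentQPT (P.complexity X) =
    2 / ((Real.log P.ω⁻¹ : EReal) * ⨆ k, (P.a k : EReal)) := by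
  have hL := P.log_inv_ω_pos
  have hle : ∀ k, (P.a k : EReal) ≤ ⨆ k, (P.a k : EReal) := le_iSup fun k => (P.a k : EReal)
  have hpos : (0 : EReal) < ⨆ k, (P.a k : EReal) :=
    lt_of_lt_of_le (by exact_mod_cast P.a_pos 0) (hle 0)
  have hup := fun z hz => P.QPTBound_of_lt_iSup X (z := z) hz
  generalize (⨆ k, (P.a k : EReal)) = l at hle hpos hup ⊢
  induction l with
  | bot => simp at hpos
  | top =>
    rw [EReal.coe_mul_top_of_pos hL, EReal.div_top]
    refine le_antisymm ?_ (le_iInf₂ fun t ht => by exact_mod_cast ht.1.le)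
    refine EReal.le_of_forall_lt_iff_le.1 fun z hz => ?_
    have hz0 : 0 < z := by exact_mod_cast hz
    exact iInf₂_le z ⟨hz0, hup z hz0 (EReal.coe_lt_top _)⟩
  | coe a =>
    have ha : 0 < a := by exact_mod_cast hpos
    have hB : (2 : EReal) / ((Real.log P.ω⁻¹ : EReal) * (a : EReal)) =
        ((2 / (Real.log P.ω⁻¹ * a) : ℝ) : EReal) := by
      rw [EReal.coe_div, EReal.coe_mul]
      rfl
    rw [hB]
    refine le_antisymm ?_ (le_iInf₂ fun t ht => ?_)
    · refine EReal.le_of_forall_lt_iff_le.1 fun z hz => ?_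
      rw [EReal.coe_lt_coe_iff] at hz
      have hz0 : 0 < z := lt_trans (by positivity) hz
      refine iInf₂_le z ⟨hz0, hup z hz0 ?_⟩
      rw [div_lt_iff₀ (by positivity)] at hz
      rw [EReal.coe_lt_coe_iff, div_lt_iff₀ (by positivity)]
      linarith
    · rw [EReal.coe_le_coe_iff, div_le_iff₀ (by positivity)]
      exact P.le_of_QPTBound X ht.1 (fun k => EReal.coe_le_coe_iff.1 (hle k)) ht.2

lemma Astar_eq : P.Astar = (Real.log P.ω⁻¹ : EReal) *
    liminf (fun k : ℕ => ((P.a k / Real.log ((k : ℝ) + 1) : ℝ) : EReal)) atTop := by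
  rw [Astar, ← EReal.liminf_const_mul_of_nonneg_of_ne_top
    (by exact_mod_cast P.log_inv_ω_pos.le) (EReal.coe_ne_top _)]
  refine congrArg (fun u => liminf u atTop) (funext fun k => ?_)
  rw [← EReal.coe_mul]
  congr 1
  ring

end KorobovParameters

end

theorem mainTheorem6 (P : KorobovParameters) (X : ErrorCriterion) :
    (P.Astar = (Real.log P.ω⁻¹ : EReal) *
      liminf (fun k : ℕ => ((P.a k / Real.log ((k : ℝ) + 1) : ℝ) : EReal)) atTop) ∧
    (IsSPT (P.complexity X) ↔ 0 < P.Astar) ∧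
    (IsSPT (P.complexity X) → exponentSPT (P.complexity X) = 2 / P.Astar) ∧
    (IsSPT (P.complexity X) ↔ IsPT (P.complexity X)) ∧
    IsQPT (P.complexity X) ∧
    (∃ l : EReal, Tendsto (fun k : ℕ => (P.a k : EReal)) atTop (𝓝 l) ∧
      exponentQPT (P.complexity X) = 2 / ((Real.log P.ω⁻¹ : EReal) * l)) ∧
    (∀ s t : ℝ, 0 < s → 0 < t → IsSTWT (P.complexity X) s t) ∧
    IsUWT (P.complexity X) ∧
    IsWT (P.complexity X) := by
  have hpos : IsSPT (P.complexity X) → 0 < P.Astar := fun h =>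
    P.Astar_pos_of_isPT X h.isPT
  have hwt : ∀ s t : ℝ, 0 < s → 0 < t → IsSTWT (P.complexity X) s t := fun s t hs ht => by
    obtain ⟨t₀, ht₀, h⟩ := P.exists_QPTBound X
    exact IsSTWT.of_QPTBound (fun d _ ε hε => P.one_le_complexity X hε d) ht₀ h hs ht
  refine ⟨P.Astar_eq, ⟨hpos, P.isSPT_of_Astar_pos X⟩, fun h => P.exponentSPT_eq X (hpos h),
    ⟨IsSPT.isPT, fun h => P.isSPT_of_Astar_pos X (P.Astar_pos_of_isPT X h)⟩,
    P.exists_QPTBound X, ⟨_, P.tendsto_a, P.exponentQPT_eq X⟩, hwt, hwt, ?_⟩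
  have h := hwt 1 1 one_pos one_pos
  simp only [IsSTWT, Real.rpow_one] at h
  exact h
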